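/- Consider the feedback loop $e=r-\mathcal C_4y$, $z=\mathcal C_1e$, $z_s=\mathcal C_sz$, $u=\mathcal C_3(m+\mathcal C_2z)$, $y=\mathcal P(u+d)$, where $\mathcal C_1,\mathcal C_2,\mathcal C_3,\mathcal C_4,\mathcal C_s,\mathcal P$ are finite-dimensional SISO LTI systems (with frequency responses $\mathcal C_1(\omega)=\mathcal C_1(s)|_{s=j\omega}$ etc.) and $m$ is the output of the reset controller $\mathcal C_r$: $$\dot x_r=A_Rx_r+B_Rz\ (t\notin J),\qquad x_r(t^+)=A_\rho x_r(t)\ (t\in J),\qquad m=C_Rx_r+D_Rz,$$ $A_\rho=\mathrm{diag}(\gamma,1,\dots,1)$, $\gamma\in(-1,1]$, with base-linear controller $\mathcal C_l(\omega)=C_R(j\omega I-A_R)^{-1}B_R+D_R$. Let $r=0$ and $d(t)=|D|\sin\omega t$ with $|D|,\omega>0$. Write the $n$th harmonic of a $2\pi/\omega$-periodic signal $f$ as $|F^n|\sin(n\omega t+\angle F^n)$ and put $F^n=|F^n|e^{j\angle F^n}$. Consider a two-reset steady-state response of the loop: a $2\pi/\omega$-periodic response, defined for all times, whose resets are triggered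 by the first harmonic $z_s^1(t)=|Z_s^1|\sin(\omega t+\angle Z_s^1)\neq0$ of $z_s$, i.e. $J=\{t: z_s^1(t)=0\}$. Assume that the loop is convergent: any two responses to this $d$ with reset instants $J$ approach each other as $t\to\infty$. Let $$\Delta_l(\omega)=(j\omega I-A_R)^{-1}B_R,\quad \Delta_x(\omega)=C_R(j\omega I-A_R)^{-1}j\omega,\quad \Delta_c(\omega)=|\Delta_l(\omega)|\sin(\angle\Delta_l(\omega)-\angle\mathcal C_s(\omega))\ \text{(entrywise)},$$ $$\Delta_q(\omega)=(I+e^{A_R\pi/\omega})(A_\rho e^{A_R\pi/\omega}+I)^{-1}(A_\rho-I)\Delta_c(\omega),\quad \mathcal C_\rho^n(\omega)=\frac{2}{n\pi}\Delta_x(n\omega)\Delta_q(\omega)e^{jn\angle\mathcal C_s(\omega)},$$ $$\mathcal L_1(\omega)=\mathcal C_1(\omega)[\mathcal C_l(\omega)+\mathcal C_\rho^1(\omega)+\mathcal C_2(\omega)]\mathcal C_3(\omega)\mathcal P(\omega),\quad \mathcal L_n(\omega)=\mathcal C_1(\omega)e^{j(n-1)\angle\mathcal C_1(\omega)}\mathcal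 C_\rho^n(\omega)\mathcal C_3(n\omega)\mathcal P(n\omega)\ (n>1\text{ odd}),$$ $$\mathcal L_l(\omega)=[\mathcal C_l(\omega)+\mathcal C_2(\omega)]\mathcal C_3(\omega)\mathcal P(\omega)\mathcal C_4(\omega)\mathcal C_1(\omega),\quad \mathcal S_l(\omega)=\frac1{1+\mathcal L_l(\omega)},$$ $$\mathcal L_\rho(n\omega)=\mathcal C_\rho^n(\omega)\mathcal C_3(n\omega)\mathcal P(n\omega)\mathcal C_4(n\omega)\mathcal C_1(n\omega),\quad \Psi_n(\omega)=\frac{|\mathcal L_\rho(n\omega)|}{|1+\mathcal L_l(n\omega)|}.$$ With $\Delta_{l,1}$ the entry of $\Delta_l$ for the reset state, let $\Delta_c^1(\omega)=|\Delta_{l,1}(\omega)|\sin(\angle\Delta_{l,1}(\omega)-\angle\mathcal C_s(\omega))$ and, for $n>1$, $\Delta_c^n(\omega)=-|\Delta_{l,1}(n\omega)|\sin(\angle\Delta_{l,1}(n\omega)+\angle\mathcal L_\rho(n\omega)-\angle(1+\mathcal L_l(n\omega))-n\angle\mathcal C_s(\omega))$, and $$\Gamma(\omega)=\Bigl(1-\sum_{n=3,5,7,\dots}\Psi_n(\omega)\Delta_c^n(\omega)/\Delta_c^1(\omega)\Bigr)^{-1},\qquad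 \mathcal L_o(\omega)=\mathcal L_1(\omega)\mathcal C_4(\omega)+(\Gamma(\omega)-1)\mathcal L_\rho(\omega).$$ Assume that these expressions make sense: no block has a pole at an odd multiple of $j\omega$, the algebraic loop is well posed ($1+\mathcal L_l(\infty)\ne0$), $A_\rho e^{A_R\pi/\omega}+I$ is invertible, and $\Delta_c^1(\omega)\neq0$. Then $1+\mathcal L_l(n\omega)\ne0$ for odd $n>1$, the series in $\Gamma(\omega)$ converges absolutely, its denominator and $1+\mathcal L_o(\omega)$ are non-zero, and the higher-order process sensitivity functions $\mathcal{PS}_n(\omega)=E^n(\omega)/D^n(\omega)$, where $D^n(\omega)$ belongs to $d^n(t)=|D|\sin n\omega t$, are $$\mathcal{PS}_n(\omega)=\begin{cases}-\mathcal P(\omega)\mathcal C_4(\omega)/(1+\mathcal L_o(\omega)),&n=1,\\-\mathcal S_l(n\omega)\,|\mathcal{PS}_1(\omega)|e^{jn\angle\mathcal{PS}_1(\omega)}\,\Gamma(\omega)\mathcal L_n(\omega)\mathcal C_4(n\omega),&n>1\text{ odd},\\0,&n\geqslant2\text{ even}.\end{cases}$$ -/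

import Mathlib

open Complex Filter Topology Matrix Set

noncomputable section

/-- The `n`-th harmonic of a `2π/ω`-periodic signal `f`, as the complex number `|F| exp (j ∠F)` for
which the `n`-th Fourier component of `f` is `|F| sin (n ω t + ∠F)`. -/
def harmonicCoeff (ω : ℝ) (n : ℕ) (f : ℝ → ℝ) : ℂ :=
  I * ((ω / Real.pi : ℝ) : ℂ) *
    ∫ t in (0 : ℝ)..(2 * Real.pi / ω), (f t : ℂ) * exp (-(I * n * ω * t))

/-- The `n`-th harmonic component of `f`, as a function of time. -/
def harmonicSignal (ω : ℝ) (n : ℕ) (f : ℝ → ℝ) (t : ℝ) : ℝ :=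
  ‖harmonicCoeff ω n f‖ * Real.sin (n * ω * t + arg (harmonicCoeff ω n f))

/-- `j ω I - A` -/
def pencil {n : ℕ} (A : Matrix (Fin n) (Fin n) ℝ) (ω : ℝ) : Matrix (Fin n) (Fin n) ℂ :=
  (I * ω) • (1 : Matrix (Fin n) (Fin n) ℂ) - A.map ofReal

/-- A finite-dimensional single-input single-output LTI system in state-space form. -/
structure LTI where
  dim : ℕ
  A : Matrix (Fin dim) (Fin dim) ℝ
  B : Fin dim → ℝ
  C : Fin dim → ℝ
  D : ℝ

namespace LTI

/-- The frequency response `C (j ω I - A)⁻¹ B + D`. -/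
def freq (G : LTI) (ω : ℝ) : ℂ :=
  (fun i => (G.C i : ℂ)) ⬝ᵥ ((pencil G.A ω)⁻¹ *ᵥ fun i => (G.B i : ℂ)) + G.D

/-- On the (open) time set `T`, the input `u` drives the state `x` and gives the output `y`. The
input may jump at the isolated instants `J`, where the state is only required to be continuous. -/
def Responds (G : LTI) (T J : Set ℝ) (u : ℝ → ℝ) (x : ℝ → Fin G.dim → ℝ) (y : ℝ → ℝ) : Prop :=
  ContinuousOn x T ∧
  (∀ t ∈ T \ J, HasDerivAt x (G.A *ᵥ x t + u t • G.B) t) ∧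
  ∀ t ∈ T, y t = G.C ⬝ᵥ x t + G.D * u t

end LTI

/-- A reset controller with `k + 1` states, of which the first one is reset, with reset value
`γ ∈ (-1, 1]`. -/
structure ResetController where
  k : ℕ
  A : Matrix (Fin (k + 1)) (Fin (k + 1)) ℝ
  B : Fin (k + 1) → ℝ
  C : Fin (k + 1) → ℝ
  D : ℝ
  γ : ℝ
  γ_mem : γ ∈ Ioc (-1 : ℝ) 1

namespace ResetController

/-- The base-linear controller. -/
def base (R : ResetController) : LTI := ⟨R.k + 1, R.A, R.B, R.C, R.D⟩

/-- The reset matrix `diag (γ, 1, …, 1)`. -/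
def Aρ (R : ResetController) : Matrix (Fin (R.k + 1)) (Fin (R.k + 1)) ℝ :=
  Matrix.diagonal (Fin.cons R.γ fun _ => 1)

/-- On the (open) time set `T`, with reset instants `J`, the input `z` drives the state `x` and
gives the output `m`. The state is left-continuous: at a reset instant `x t` is the value before
the reset. -/
def Responds (R : ResetController) (T J : Set ℝ) (z : ℝ → ℝ) (x : ℝ → Fin (R.k + 1) → ℝ)
    (m : ℝ → ℝ) : Prop :=
  (∀ t ∈ T \ J, HasDerivAt x (R.A *ᵥ x t + z t • R.B) t) ∧
  (∀ t ∈ T ∩ J, Tendsto x (𝓝[<] t) (𝓝 (x t)) ∧ Tendsto x (𝓝[>] t) (𝓝 (R.Aρ *ᵥ x t))) ∧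
  ∀ t ∈ T, m t = R.C ⬝ᵥ x t + R.D * z t

/-- `exp (A_R π / ω)` -/
def expHalf (R : ResetController) (ω : ℝ) : Matrix (Fin (R.k + 1)) (Fin (R.k + 1)) ℝ :=
  NormedSpace.exp ((Real.pi / ω) • R.A)

/-- `Δ_l(ω) = (j ω I - A_R)⁻¹ B_R` -/
def Δl (R : ResetController) (ω : ℝ) : Fin (R.k + 1) → ℂ :=
  (pencil R.A ω)⁻¹ *ᵥ fun i => (R.B i : ℂ)

/-- The row vector `Δ_x(ω) = C_R (j ω I - A_R)⁻¹ j ω`. -/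
def Δx (R : ResetController) (ω : ℝ) : Fin (R.k + 1) → ℂ :=
  (I * ω) • ((fun i => (R.C i : ℂ)) ᵥ* (pencil R.A ω)⁻¹)

end ResetController

/-- The blocks of the generalized reset feedback loop. -/
structure ResetLoop where
  Cr : ResetController
  C1 : LTI
  C2 : LTI
  C3 : LTI
  C4 : LTI
  Cs : LTI
  P : LTI

namespace ResetLoop

/-- The block states and the signals of the loop, as functions of time. -/
structure Trajectory (S : ResetLoop) where
  xr : ℝ → Fin (S.Cr.k + 1) → ℝ
  x1 : ℝ → Fin S.C1.dim → ℝ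
  x2 : ℝ → Fin S.C2.dim → ℝ
  x3 : ℝ → Fin S.C3.dim → ℝ
  x4 : ℝ → Fin S.C4.dim → ℝ
  xs : ℝ → Fin S.Cs.dim → ℝ
  xP : ℝ → Fin S.P.dim → ℝ
  /-- error -/
  e : ℝ → ℝ
  /-- input of the reset controller -/
  z : ℝ → ℝ
  /-- output of the shaping filter -/
  zs : ℝ → ℝ
  /-- output of the reset controller -/
  m : ℝ → ℝ
  /-- output of the branch parallel to the reset controller -/
  a : ℝ → ℝ
  /-- control input -/
  u : ℝ → ℝ
  /-- system output -/
  y : ℝ → ℝ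
  /-- fed-back output -/
  f : ℝ → ℝ

/-- The state of the whole closed loop. -/
def Trajectory.state {S : ResetLoop} (X : S.Trajectory) (t : ℝ) :
    (Fin (S.Cr.k + 1) → ℝ) × (Fin S.C1.dim → ℝ) × (Fin S.C2.dim → ℝ) × (Fin S.C3.dim → ℝ) ×
      (Fin S.C4.dim → ℝ) × (Fin S.Cs.dim → ℝ) × (Fin S.P.dim → ℝ) :=
  (X.xr t, X.x1 t, X.x2 t, X.x3 t, X.x4 t, X.xs t, X.xP t)

/-- `X` satisfies the loop equations on the time set `T` with reference `r`, disturbance `d` (added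
at the plant input) and reset instants `J`:
`z = C₁ e`, `z_s = C_s z`, `m = C_r z`, `a = C₂ z`, `u = C₃ (m + a)`, `y = P (u + d)`,
`e = r - C₄ y`. -/
structure IsResponse (S : ResetLoop) (T J : Set ℝ) (r d : ℝ → ℝ) (X : S.Trajectory) : Prop where
  c1 : S.C1.Responds T J X.e X.x1 X.z
  cs : S.Cs.Responds T J X.z X.xs X.zs
  cr : S.Cr.Responds T J X.z X.xr X.m
  c2 : S.C2.Responds T J X.z X.x2 X.a
  c3 : S.C3.Responds T J (fun t => X.m t + X.a t) X.x3 X.u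
  p : S.P.Responds T J (fun t => X.u t + d t) X.xP X.y
  c4 : S.C4.Responds T J X.y X.x4 X.f
  err : ∀ t ∈ T, X.e t = r t - X.f t

/-- Convergence: any two responses of the loop to the same inputs approach each other. -/
def IsConvergent (S : ResetLoop) (J : Set ℝ) (r d : ℝ → ℝ) : Prop :=
  ∀ X Y : S.Trajectory, S.IsResponse (Ioi 0) J r d X → S.IsResponse (Ioi 0) J r d Y →
    Tendsto (fun t => X.state t - Y.state t) atTop (𝓝 0)

/-- The zero-crossing instants of the first harmonic `z_s¹` of the output of the shaping filter. -/
def resetInstants {S : ResetLoop} (ω : ℝ) (X : S.Trajectory) : Set ℝ :=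
  {t | harmonicSignal ω 1 X.zs t = 0}

/-- A steady-state response of the two-reset closed loop to inputs of frequency `ω`: a
`2π/ω`-periodic response defined for all times, whose resets are triggered by the (non-zero) first
harmonic `z_s¹`. -/
structure IsTwoResetSteadyState (S : ResetLoop) (ω : ℝ) (r d : ℝ → ℝ) (X : S.Trajectory) :
    Prop where
  response : S.IsResponse univ (resetInstants ω X) r d X
  periodic : Function.Periodic X.state (2 * Real.pi / ω)
  trigger_ne_zero : harmonicCoeff ω 1 X.zs ≠ 0

/-- The algebraic loop of the base-linear system is well posed. -/
def WellPosed (S : ResetLoop) : Prop :=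
  1 + (S.Cr.D + S.C2.D) * S.C3.D * S.P.D * S.C4.D * S.C1.D ≠ 0

/-- No block has a pole at an odd multiple of `j ω`. -/
def FreqDefined (S : ResetLoop) (ω : ℝ) : Prop :=
  ∀ n : ℕ, Odd n → ∀ G ∈ [S.Cr.base, S.C1, S.C2, S.C3, S.C4, S.Cs, S.P],
    (pencil G.A (n * ω)).det ≠ 0

/-- The vector of the `|Δ_l(ω)| sin (∠Δ_l(ω) - ∠C_s(ω))`, entry by entry. -/
def Δc (S : ResetLoop) (ω : ℝ) : Fin (S.Cr.k + 1) → ℝ := fun i =>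
  ‖S.Cr.Δl ω i‖ * Real.sin (arg (S.Cr.Δl ω i) - arg (S.Cs.freq ω))

/-- `Δ_q(ω) = (I + e^{A_R π/ω}) (A_ρ e^{A_R π/ω} + I)⁻¹ (A_ρ - I) Δ_c(ω)` -/
def Δq (S : ResetLoop) (ω : ℝ) : Fin (S.Cr.k + 1) → ℝ :=
  ((1 + S.Cr.expHalf ω) * (S.Cr.Aρ * S.Cr.expHalf ω + 1)⁻¹ * (S.Cr.Aρ - 1)) *ᵥ S.Δc ω

/-- `C_ρⁿ(ω) = 2 Δ_x(nω) Δ_q(ω) e^{j n ∠C_s(ω)} / (n π)` -/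
def Cρ (S : ResetLoop) (ω : ℝ) (n : ℕ) : ℂ :=
  2 * (S.Cr.Δx (n * ω) ⬝ᵥ fun i => (S.Δq ω i : ℂ)) * exp (I * n * arg (S.Cs.freq ω)) /
    (n * Real.pi)

/-- The open-loop higher-order describing functions `L_n(ω)`. -/
def L (S : ResetLoop) (ω : ℝ) (n : ℕ) : ℂ :=
  if n = 1 then
    S.C1.freq ω * (S.Cr.base.freq ω + S.Cρ ω 1 + S.C2.freq ω) * S.C3.freq ω * S.P.freq ω
  else if Odd n then
    S.C1.freq ω * exp (I * (n - 1) * arg (S.C1.freq ω)) * S.Cρ ω n * S.C3.freq (n * ω) *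
      S.P.freq (n * ω)
  else 0

/-- The base-linear loop gain `L_l(ω)`. -/
def Ll (S : ResetLoop) (ω : ℝ) : ℂ :=
  (S.Cr.base.freq ω + S.C2.freq ω) * S.C3.freq ω * S.P.freq ω * S.C4.freq ω * S.C1.freq ω

/-- The base-linear sensitivity function `S_l(ω)`. -/
def Sl (S : ResetLoop) (ω : ℝ) : ℂ := 1 / (1 + S.Ll ω)

/-- `L_ρ(nω)`, which depends on `n` and `ω` separately through `C_ρⁿ(ω)`. -/
def Lρ (S : ResetLoop) (ω : ℝ) (n : ℕ) : ℂ :=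
  S.Cρ ω n * S.C3.freq (n * ω) * S.P.freq (n * ω) * S.C4.freq (n * ω) * S.C1.freq (n * ω)

/-- `Ψ_n(ω)` -/
def Ψ (S : ResetLoop) (ω : ℝ) (n : ℕ) : ℝ := ‖S.Lρ ω n‖ / ‖1 + S.Ll (n * ω)‖

/-- `Δ_cⁿ(ω)`, taken at the state that is reset. -/
def Δcn (S : ResetLoop) (ω : ℝ) (n : ℕ) : ℝ :=
  if n = 1 then S.Δc ω 0
  else -(‖S.Cr.Δl (n * ω) 0‖ * Real.sin (arg (S.Cr.Δl (n * ω) 0) + arg (S.Lρ ω n) -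
    arg (1 + S.Ll (n * ω)) - n * arg (S.Cs.freq ω)))

/-- The terms, for `n = 2 k + 3`, of the series in `Γ(ω)`. -/
def ΓTerm (S : ResetLoop) (ω : ℝ) (k : ℕ) : ℝ := S.Ψ ω (2 * k + 3) * S.Δcn ω (2 * k + 3)

/-- The denominator `1 - ∑_{n = 3, 5, …} Ψ_n(ω) Δ_cⁿ(ω) / Δ_c¹(ω)` of `Γ(ω)`. -/
def ΓDen (S : ResetLoop) (ω : ℝ) : ℝ := 1 - (∑' k, S.ΓTerm ω k) / S.Δcn ω 1

/-- `Γ(ω)` -/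
def Γ (S : ResetLoop) (ω : ℝ) : ℝ := 1 / S.ΓDen ω

/-- `L_o(ω) = L_1(ω) C₄(ω) + (Γ(ω) - 1) L_ρ(ω)`, which is `L_l(ω) + Γ(ω) L_ρ(ω)`. -/
def Lo (S : ResetLoop) (ω : ℝ) : ℂ := S.L ω 1 * S.C4.freq ω + (S.Γ ω - 1) * S.Lρ ω 1

/-- The higher-order process sensitivity function `PS_n(ω) = Eⁿ(ω) / Dⁿ(ω)` of a steady-state
response `X` to the disturbance `D sin (ω t)`, where `Dⁿ` belongs to the virtual harmonic
`D sin (n ω t)`. -/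
def PS {S : ResetLoop} (ω D : ℝ) (X : S.Trajectory) (n : ℕ) : ℂ :=
  harmonicCoeff ω n X.e / harmonicCoeff ω n fun t => D * Real.sin (n * ω * t)

end ResetLoop

end

/-! With the reset instants `J` held fixed the loop is linear, and `J` is invariant under a shift by
half a period. So `-X (t + π/ω)` is a response to the same disturbance; convergence and periodicity
force it to equal `X` on the level of states (`state_antiperiodic`). Hence even harmonics vanish,
and odd ones are integrals over one half period between consecutive resets. Transforming `x' = A x +
u B` there, the boundary terms cancel for a continuous antiperiodic state; for the reset controller
they leave the jump `(A_ρ - 1) x_r(a)`. Each block thus acts on odd harmonics by its frequency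
response, and the resets act as an extra source of unknown amplitude.

That amplitude is a single scalar. Subtracting a suitable free motion from `x_r` gives the
continuous steady-state response of the base-linear controller to `z`; its value at the reset
instant determines the jump (`exists_baseLinear`), and since `A_ρ - 1` sees only the reset state,
the jump is a multiple of `Δ_q` (`jump_eq_smul_Δq`). Let `c` be its ratio to the jump that the first
harmonic of `z` alone would cause. The Fourier series of the reset state at the reset instant has a
first term proportional to `Δ_c¹`, while for `n > 1` the harmonics of `z` are themselves caused by
the jump, hence proportional to `c`. This gives `c Δ_c¹ = Δ_c¹ + c ∑ Ψ_n Δ_cⁿ`, so `c` times the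
denominator of `Γ` is `1`: the denominator is non-zero and `c = Γ` (`harmonic_balance`). The
formulas follow by solving the balance at each `n`.

Two facts make this legitimate. If `1 + L_l(nω)` vanished, the loop would have an undamped
oscillation whose phase can be chosen so that resets do not affect it, against convergence
(`one_add_Ll_ne_zero`). And the terms of the series are `O(1/n²)` (`summable_Ψ_mul_Δl`). -/

noncomputable section

/-! ### Signals between two consecutive resets. -/

/-- `f` is left-continuous on `(a, b]`, without jumps inside, and has a right limit at `a`. -/
def SegCont {E : Type*} [TopologicalSpace E] (a b : ℝ) (f : ℝ → E) : Prop :=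
  ContinuousOn f (Ioc a b) ∧ ∃ l, Tendsto f (𝓝[>] a) (𝓝 l)

/-- The Fourier-Laplace integral of `f` over `[a, b]` at the complex frequency `s`. -/
def segLaplace (a b : ℝ) (s : ℂ) (f : ℝ → ℝ) : ℂ := ∫ t in a..b, (f t : ℂ) * exp (-(s * t))

namespace SegCont

variable {a b : ℝ}

theorem of_continuousOn {E : Type*} [TopologicalSpace E] {f : ℝ → E} (hab : a < b)
    (hf : ContinuousOn f (Icc a b)) : SegCont a b f :=
  ⟨hf.mono Ioc_subset_Icc_self, f a, ((hf a (left_mem_Icc.2 hab.le)).mono_of_mem_nhdsWithin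
    (Icc_mem_nhdsGT hab)).tendsto⟩

theorem add {f g : ℝ → ℝ} (hf : SegCont a b f) (hg : SegCont a b g) :
    SegCont a b fun t => f t + g t := by
  obtain ⟨hf, l, hl⟩ := hf
  obtain ⟨hg, k, hk⟩ := hg
  exact ⟨hf.add hg, _, hl.add hk⟩

theorem const_mul {f : ℝ → ℝ} (hf : SegCont a b f) (c : ℝ) : SegCont a b fun t => c * f t := by
  obtain ⟨hf, l, hl⟩ := hf
  exact ⟨continuousOn_const.mul hf, _, hl.const_mul c⟩

theorem const_mul' {f : ℝ → ℂ} (hf : SegCont a b f) (c : ℂ) : SegCont a b fun t => c * f t := by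
  obtain ⟨hf, l, hl⟩ := hf
  exact ⟨continuousOn_const.mul hf, _, hl.const_mul c⟩

theorem apply {ι : Type*} {f : ℝ → ι → ℝ} (hf : SegCont a b f) (i : ι) :
    SegCont a b fun t => f t i := by
  obtain ⟨hf, l, hl⟩ := hf
  exact ⟨continuousOn_pi.1 hf i, _, tendsto_pi_nhds.1 hl i⟩

theorem dotProduct {ι : Type*} [Fintype ι] {f : ℝ → ι → ℝ} (hf : SegCont a b f) (c : ι → ℝ) :
    SegCont a b fun t => c ⬝ᵥ f t := by
  obtain ⟨hf, l, hl⟩ := hf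
  refine ⟨?_, c ⬝ᵥ l, ?_⟩
  · exact Continuous.comp_continuousOn (g := fun v => c ⬝ᵥ v) (by fun_prop) hf
  · exact ((by fun_prop : Continuous fun v => c ⬝ᵥ v).tendsto l).comp hl

theorem congr {f g : ℝ → ℝ} (hab : a < b) (hf : SegCont a b f) (h : ∀ t ∈ Ioc a b, g t = f t) :
    SegCont a b g := by
  obtain ⟨hf, l, hl⟩ := hf
  exact ⟨hf.congr h, l, hl.congr' <| by
    filter_upwards [Ioc_mem_nhdsGT hab] with t ht using (h t ht).symm⟩

/-- Filling in the right limit at `a` gives a continuous function on `[a, b]`. -/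
theorem continuousOn_update {E : Type*} [TopologicalSpace E] {f : ℝ → E} {l : E}
    (hf : ContinuousOn f (Ioc a b)) (hl : Tendsto f (𝓝[>] a) (𝓝 l)) :
    ContinuousOn (Function.update f a l) (Icc a b) := by
  rw [continuousOn_update_iff]
  refine ⟨hf.mono fun t ht => ⟨lt_of_le_of_ne ht.1.1 (Ne.symm ht.2), ht.1.2⟩, fun _ => ?_⟩
  exact hl.mono_left (nhdsWithin_mono _ fun t ht => lt_of_le_of_ne ht.1.1 (Ne.symm ht.2))

theorem mul_exp {f : ℝ → ℝ} (hf : SegCont a b f) (s : ℂ) :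
    SegCont a b fun t : ℝ => (f t : ℂ) * exp (-(s * t)) := by
  obtain ⟨hf, l, hl⟩ := hf
  have hc : Continuous fun t : ℝ => exp (-(s * t)) := by fun_prop
  refine ⟨(continuous_ofReal.comp_continuousOn hf).mul hc.continuousOn, l * exp (-(s * a)), ?_⟩
  exact ((continuous_ofReal.tendsto l).comp hl).mul (hc.continuousAt.tendsto.mono_left
    nhdsWithin_le_nhds)

theorem intervalIntegrable {f : ℝ → ℂ} (hab : a < b) (hf : SegCont a b f) :
    IntervalIntegrable f MeasureTheory.volume a b := by
  obtain ⟨hf, l, hl⟩ := hf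
  have := (continuousOn_update hf hl).intervalIntegrable_of_Icc (μ := MeasureTheory.volume) hab.le
  refine this.congr fun t ht => ?_
  rw [uIoc_of_le hab.le] at ht
  exact Function.update_of_ne ht.1.ne' _ _

end SegCont

/-! ### Fourier-Laplace integrals over a half period. -/

section segLaplace

variable {a b : ℝ} (s : ℂ)

theorem segLaplace_add (hab : a < b) {f g : ℝ → ℝ} (hf : SegCont a b f) (hg : SegCont a b g) :
    segLaplace a b s (fun t => f t + g t) = segLaplace a b s f + segLaplace a b s g := by
  rw [segLaplace, segLaplace, segLaplace, ← intervalIntegral.integral_add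
    ((hf.mul_exp s).intervalIntegrable hab) ((hg.mul_exp s).intervalIntegrable hab)]
  exact intervalIntegral.integral_congr fun t _ => by push_cast; ring

theorem segLaplace_const_mul (c : ℝ) (f : ℝ → ℝ) :
    segLaplace a b s (fun t => c * f t) = c * segLaplace a b s f := by
  rw [segLaplace, segLaplace, ← intervalIntegral.integral_const_mul]
  exact intervalIntegral.integral_congr fun t _ => by push_cast; ring

theorem segLaplace_congr (hab : a < b) {f g : ℝ → ℝ} (h : ∀ t ∈ Ioc a b, f t = g t) :
    segLaplace a b s f = segLaplace a b s g := by
  refine intervalIntegral.integral_congr_ae (Eventually.of_forall fun t ht => ?_)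
  rw [uIoc_of_le hab.le] at ht
  simp [h t ht]

theorem segLaplace_dotProduct (hab : a < b) {ι : Type*} [Fintype ι] (c : ι → ℝ) {x : ℝ → ι → ℝ}
    (hx : SegCont a b x) :
    segLaplace a b s (fun t => c ⬝ᵥ x t) =
      (fun i => (c i : ℂ)) ⬝ᵥ fun i => segLaplace a b s fun t => x t i := by
  simp only [segLaplace, dotProduct]
  have (i : ι) : IntervalIntegrable (fun t : ℝ => (c i : ℂ) * ((x t i : ℂ) * exp (-(s * t))))
      MeasureTheory.volume a b :=
    ((((hx.apply i).mul_exp s).const_mul' _).intervalIntegrable hab)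
  simp_rw [← intervalIntegral.integral_const_mul]
  rw [← intervalIntegral.integral_finsetSum fun i _ => this i]
  refine intervalIntegral.integral_congr fun t _ => ?_
  simp only [ofReal_sum, ofReal_mul, Finset.sum_mul]
  exact Finset.sum_congr rfl fun i _ => by ring

/-- The transform of a derivative, when `exp (s (b - a)) = -1`. -/
theorem segLaplace_deriv (hab : a < b) (hs : exp (-(s * b)) = -exp (-(s * a)))
    {f f' : ℝ → ℝ} {l : ℝ} (hf : ContinuousOn f (Ioc a b)) (hl : Tendsto f (𝓝[>] a) (𝓝 l))
    (hf' : SegCont a b f') (h : ∀ t ∈ Ioo a b, HasDerivAt f (f' t) t) :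
    segLaplace a b s f' = s * segLaplace a b s f - exp (-(s * a)) * (l + f b) := by
  have hSf : SegCont a b f := ⟨hf, l, hl⟩
  have hexp (t : ℝ) : HasDerivAt (fun t : ℝ => exp (-(s * t))) (exp (-(s * t)) * (-(s * 1))) t :=
    ((((hasDerivAt_id (t : ℂ)).const_mul s).neg).cexp).comp_ofReal
  have hc : Continuous fun t : ℝ => exp (-(s * t)) := by fun_prop
  -- Integration by parts with the right limit `l` in place of `f a`, so that a jump at `a` is
  -- allowed. By `hs` the two boundary terms acquire the same sign.
  have key := intervalIntegral.integral_eq_sub_of_hasDerivAt_of_tendsto (a := a) (b := b)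
    (f := fun t : ℝ => (f t : ℂ) * exp (-(s * t)))
    (f' := fun t : ℝ => (f' t : ℂ) * exp (-(s * t)) + -s * ((f t : ℂ) * exp (-(s * t)))) hab
    (fa := l * exp (-(s * a))) (fb := f b * exp (-(s * b)))
    (fun t ht => by
      convert! (h t ht).ofReal_comp.mul (hexp t) using 1
      ring)
    (((hf'.mul_exp s).intervalIntegrable hab).add
      (((hSf.mul_exp s).const_mul' (-s)).intervalIntegrable hab))
    (((continuous_ofReal.tendsto l).comp hl).mul (hc.continuousAt.tendsto.mono_left
      nhdsWithin_le_nhds))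
    (by
      have hb : Tendsto f (𝓝[<] b) (𝓝 (f b)) :=
        ((hf b (right_mem_Ioc.2 hab)).mono_of_mem_nhdsWithin (Ioc_mem_nhdsLT hab)).tendsto
      exact ((continuous_ofReal.tendsto _).comp hb).mul (hc.continuousAt.tendsto.mono_left
        nhdsWithin_le_nhds))
  rw [intervalIntegral.integral_add ((hf'.mul_exp s).intervalIntegrable hab)
    (((hSf.mul_exp s).const_mul' (-s)).intervalIntegrable hab),
    intervalIntegral.integral_const_mul, hs] at key
  simp only [segLaplace]
  linear_combination key

/-- The transform of the state equation `x' = A x + u B`. -/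
theorem pencil_mulVec_segLaplace (hab : a < b) (ν : ℝ)
    (hs : exp (-(I * ν * b)) = -exp (-(I * ν * a))) {d : ℕ} (A : Matrix (Fin d) (Fin d) ℝ)
    (B : Fin d → ℝ) {u : ℝ → ℝ} {x : ℝ → Fin d → ℝ} {l : Fin d → ℝ} (hu : SegCont a b u)
    (hx : ContinuousOn x (Ioc a b)) (hl : Tendsto x (𝓝[>] a) (𝓝 l))
    (h : ∀ t ∈ Ioo a b, HasDerivAt x (A *ᵥ x t + u t • B) t) :
    pencil A ν *ᵥ (fun i => segLaplace a b (I * ν) fun t => x t i) =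
      fun i => segLaplace a b (I * ν) u * B i + exp (-(I * ν * a)) * (l i + x b i : ℝ) := by
  ext i
  have hSx : SegCont a b x := ⟨hx, l, hl⟩
  have hder : SegCont a b fun t => A i ⬝ᵥ x t + B i * u t := (hSx.dotProduct _).add (hu.const_mul _)
  have h1 := segLaplace_deriv (I * ν) hab hs (continuousOn_pi.1 hx i) (tendsto_pi_nhds.1 hl i)
    hder (fun t ht => by
      convert! hasDerivAt_pi.1 (h t ht) i using 1
      simp [mulVec, mul_comm])
  rw [segLaplace_add _ hab (hSx.dotProduct _) (hu.const_mul _), segLaplace_const_mul,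
    segLaplace_dotProduct _ hab _ hSx] at h1
  rw [pencil, sub_mulVec, smul_mulVec, one_mulVec]
  simp only [Pi.sub_apply, Pi.smul_apply, smul_eq_mul, mulVec, Matrix.map_apply]
  push_cast
  linear_combination -h1

end segLaplace

/-! ### Harmonics and Fourier series of antiperiodic signals. -/

theorem exp_I_mul_add_pi_div (n : ℕ) {ω : ℝ} (hω : 0 < ω) (t : ℝ) :
    exp (-(I * ((n * ω : ℝ) : ℂ) * ((t + Real.pi / ω : ℝ) : ℂ))) =
      (-1) ^ n * exp (-(I * ((n * ω : ℝ) : ℂ) * t)) := by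
  have hω' : (ω : ℂ) ≠ 0 := by exact_mod_cast hω.ne'
  have h1 : -(I * ((n * ω : ℝ) : ℂ) * ((t + Real.pi / ω : ℝ) : ℂ)) =
      n * (-(Real.pi * I)) + -(I * ((n * ω : ℝ) : ℂ) * t) := by
    push_cast
    field_simp
    ring
  rw [h1, exp_add, exp_nat_mul, exp_neg, exp_pi_mul_I]
  norm_num

/-- A shift by half a period multiplies the integrand by `-(-1)^n`, so the two halves cancel for
even `n` and agree for odd `n`. The integrand is periodic, so the half period may start anywhere, in
particular at a reset instant. -/
theorem harmonicCoeff_of_antiperiodic {ω a : ℝ} (hω : 0 < ω) {f : ℝ → ℝ}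
    (hf : Function.Antiperiodic f (Real.pi / ω)) (hS : SegCont a (a + Real.pi / ω) f) (n : ℕ) :
    harmonicCoeff ω n f = I * ((ω / Real.pi : ℝ) : ℂ) * (1 - (-1) ^ n) *
      segLaplace a (a + Real.pi / ω) (I * (n * ω : ℝ)) f := by
  set h := Real.pi / ω with hh
  have hpos : 0 < h := by positivity
  set g : ℝ → ℂ := fun t => (f t : ℂ) * exp (-(I * (n * ω : ℝ) * t)) with hg
  have hshift (t : ℝ) : g (t + h) = -(-1) ^ n * g t := by
    simp only [hg, hf t]
    rw [hh, exp_I_mul_add_pi_div n hω t]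
    push_cast
    ring
  have hint : IntervalIntegrable g MeasureTheory.volume a (a + h) :=
    (hS.mul_exp _).intervalIntegrable (by linarith)
  have hint' : IntervalIntegrable g MeasureTheory.volume (a + h) (a + h + h) := by
    have h1 : IntervalIntegrable (fun t => g (t + h)) MeasureTheory.volume a (a + h) := by
      simp_rw [hshift]
      exact hint.const_mul _
    simpa using h1.comp_sub_right h
  have hper : Function.Periodic g (h + h) := fun t => by
    rw [← add_assoc, hshift, hshift, ← mul_assoc, neg_mul_neg, ← pow_add, ← two_mul, pow_mul]
    simp
  have h2 : ∫ t in (0 : ℝ)..(2 * Real.pi / ω), (f t : ℂ) * exp (-(I * n * ω * t)) =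
      ∫ t in a..a + (h + h), g t := by
    rw [hper.intervalIntegral_add_eq a 0, zero_add, hh, ← add_div, ← two_mul]
    exact intervalIntegral.integral_congr fun t _ => by simp [hg, mul_assoc]
  rw [harmonicCoeff, h2, ← add_assoc, ← intervalIntegral.integral_add_adjacent_intervals hint hint',
    ← intervalIntegral.integral_comp_add_right g h]
  simp_rw [hshift]
  rw [intervalIntegral.integral_const_mul, segLaplace]
  ring

theorem harmonicCoeff_odd {ω a : ℝ} (hω : 0 < ω) {f : ℝ → ℝ}
    (hf : Function.Antiperiodic f (Real.pi / ω)) (hS : SegCont a (a + Real.pi / ω) f) {n : ℕ}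
    (hn : Odd n) :
    harmonicCoeff ω n f = 2 * I * ((ω / Real.pi : ℝ) : ℂ) *
      segLaplace a (a + Real.pi / ω) (I * (n * ω : ℝ)) f := by
  rw [harmonicCoeff_of_antiperiodic hω hf hS, hn.neg_one_pow]
  ring

theorem harmonicCoeff_even {ω a : ℝ} (hω : 0 < ω) {f : ℝ → ℝ}
    (hf : Function.Antiperiodic f (Real.pi / ω)) (hS : SegCont a (a + Real.pi / ω) f) {n : ℕ}
    (hn : Even n) : harmonicCoeff ω n f = 0 := by
  rw [harmonicCoeff_of_antiperiodic hω hf hS, hn.neg_one_pow]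
  ring

theorem harmonicCoeff_sin {ω : ℝ} (hω : 0 < ω) (D : ℝ) {n : ℕ} (hn : n ≠ 0) :
    harmonicCoeff ω n (fun t => D * Real.sin (n * ω * t)) = D := by
  have hω' : (ω : ℂ) ≠ 0 := by exact_mod_cast hω.ne'
  have hn' : (n : ℂ) ≠ 0 := by exact_mod_cast hn
  have hπ : (Real.pi : ℂ) ≠ 0 := by exact_mod_cast Real.pi_ne_zero
  have h1 (t : ℝ) : ((D * Real.sin (n * ω * t) : ℝ) : ℂ) * exp (-(I * n * ω * t)) =
      D * I / 2 * (exp (-(2 * I * n * ω) * t) - 1) := by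
    push_cast
    rw [Complex.sin]
    have : exp (-(2 * I * n * ω) * t) = exp (-(n * ω * t) * I) * exp (-(I * n * ω * t)) := by
      rw [← exp_add]; ring_nf
    rw [this]
    have h2 : exp (n * ω * t * I) * exp (-(I * n * ω * t)) = 1 := by
      rw [← exp_add]; ring_nf; exact exp_zero
    linear_combination -D * I / 2 * h2
  have hc : -(2 * I * n * ω : ℂ) ≠ 0 := by
    simp [hω', hn', I_ne_zero]
  rw [harmonicCoeff]
  simp_rw [h1]
  rw [intervalIntegral.integral_const_mul, intervalIntegral.integral_sub
    (Continuous.intervalIntegrable (by fun_prop) _ _) (by simp), integral_exp_mul_complex hc]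
  have h3 : -(2 * I * n * ω) * ((2 * Real.pi / ω : ℝ) : ℂ) = ((-(2 * n : ℤ) : ℤ) : ℂ) * (2 * Real.pi * I) := by
    push_cast
    field_simp
  rw [h3, exp_int_mul_two_pi_mul_I]
  simp only [ofReal_zero, mul_zero, exp_zero, sub_self, zero_div, zero_sub,
    intervalIntegral.integral_const, sub_zero]
  simp only [real_smul, mul_one]
  push_cast
  field_simp
  linear_combination (-D : ℂ) * I_sq

theorem segLaplace_conj (a b : ℝ) (s : ℂ) (f : ℝ → ℝ) :
    segLaplace a b ((starRingEnd ℂ) s) f = (starRingEnd ℂ) (segLaplace a b s f) := by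
  simp only [segLaplace, intervalIntegral, map_sub, ← integral_conj]
  simp [← Complex.exp_conj]

/-- Pointwise convergence, at an end of a half period, of the Fourier series of a continuous
function with only odd harmonics. -/
theorem hasSum_odd_harmonics {ω a : ℝ} (hω : 0 < ω) {f : ℝ → ℝ}
    (hf : ContinuousOn f (Icc a (a + Real.pi / ω))) (hend : f (a + Real.pi / ω) = -f a)
    (hsum : Summable fun k : ℕ =>
      segLaplace a (a + Real.pi / ω) (I * ((2 * k + 1 : ℕ) * ω : ℝ)) f) :
    HasSum (fun k : ℕ => (2 * I * ((ω / Real.pi : ℝ) : ℂ) *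
      segLaplace a (a + Real.pi / ω) (I * ((2 * k + 1 : ℕ) * ω : ℝ)) f *
        exp (I * ((2 * k + 1 : ℕ) * ω : ℝ) * a)).im) (f a) := by
  set T := Real.pi / ω with hT
  have hTpos : 0 < T := by positivity
  have : Fact (0 < T) := ⟨hTpos⟩
  have hω' : (ω : ℂ) ≠ 0 := by exact_mod_cast hω.ne'
  have hπ : (Real.pi : ℂ) ≠ 0 := by exact_mod_cast Real.pi_ne_zero
  -- The factor `exp (-iωt)` turns the antiperiodic `f` into a function on the circle of length
  -- `π/ω`, whose coefficient of index `n` belongs to the harmonic `2n + 1` of `f`.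
  set φ : ℝ → ℂ := fun t => (f t : ℂ) * exp (-(I * ω * t)) with hφ
  have hφend : φ a = φ (a + T) := by
    have := exp_I_mul_add_pi_div 1 hω a
    simp only [Nat.cast_one, one_mul, pow_one] at this
    simp only [hφ, hend]
    rw [hT, this]
    push_cast
    ring
  have hφc : ContinuousOn φ (Icc a (a + T)) :=
    (continuous_ofReal.comp_continuousOn hf).mul (by fun_prop : Continuous fun t : ℝ =>
      exp (-(I * ω * t))).continuousOn
  let Φ : C(AddCircle T, ℂ) := ⟨AddCircle.liftIco T a φ, AddCircle.liftIco_continuous hφend hφc⟩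
  have hcoef (n : ℤ) : fourierCoeff Φ n =
      ((ω / Real.pi : ℝ) : ℂ) * segLaplace a (a + T) (I * ((2 * n + 1) * ω : ℝ)) f := by
    change fourierCoeff (AddCircle.liftIco T a φ) n = _
    rw [fourierCoeff_liftIco_eq, fourierCoeffOn_eq_integral, segLaplace, add_sub_cancel_left,
      real_smul]
    congr 1
    · rw [hT]; push_cast; field_simp
    · refine intervalIntegral.integral_congr fun t _ => ?_
      simp only [fourier_coe_apply, hφ, smul_eq_mul]
      rw [mul_left_comm, ← exp_add]
      congr 2
      rw [hT]
      push_cast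
      field_simp
      ring
  -- The indices `k` and `-(k + 1)` belong to the frequencies `±(2k + 1)ω`; as `f` is real, pairing
  -- them gives twice a real part.
  have hneg (k : ℕ) : fourierCoeff Φ (-(k + 1)) = (starRingEnd ℂ) (fourierCoeff Φ k) := by
    rw [hcoef, hcoef, map_mul, conj_ofReal, ← segLaplace_conj, map_mul, conj_I, conj_ofReal]
    congr 2
    push_cast
    ring
  have hs1 : Summable fun k : ℕ => fourierCoeff Φ k := by
    simp_rw [hcoef]
    exact (hsum.mul_left ((ω / Real.pi : ℝ) : ℂ)).congr fun k => by push_cast; rfl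
  have hs2 : Summable fun k : ℕ => fourierCoeff Φ (-(k + 1)) := by
    simp_rw [hneg]
    exact (Complex.conjCLE.summable (f := fun k : ℕ => fourierCoeff Φ k)).2 hs1
  have key := (has_pointwise_sum_fourier_series_of_summable
    (hs1.of_nat_of_neg_add_one hs2) (a : AddCircle T)).nat_add_neg_add_one.mul_right (exp (I * ω * a))
  have hval : Φ (a : AddCircle T) * exp (I * ω * a) = f a := by
    change AddCircle.liftIco T a φ a * _ = _
    rw [AddCircle.liftIco_coe_apply (left_mem_Ico.2 (by linarith)), hφ]
    simp only [mul_assoc, ← exp_add]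
    simp
  rw [hval] at key
  have key2 := Complex.hasSum_re key
  rw [ofReal_re] at key2
  convert key2 using 2 with k
  set w := fourierCoeff Φ k * exp (I * ((2 * k + 1 : ℕ) * ω : ℝ) * a) with hw
  have h1 : (fourierCoeff Φ k • fourier k (a : AddCircle T)) * exp (I * ω * a) = w := by
    rw [smul_eq_mul, fourier_coe_apply, mul_assoc, ← exp_add, hw]
    congr 2
    rw [hT]
    push_cast
    field_simp
  have h2 : (fourierCoeff Φ (-(k + 1)) • fourier (-(k + 1)) (a : AddCircle T)) * exp (I * ω * a) =
      (starRingEnd ℂ) w := by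
    rw [hneg, hw, map_mul, ← Complex.exp_conj, smul_eq_mul, fourier_coe_apply, mul_assoc, ← exp_add]
    congr 2
    simp only [map_mul, conj_I, conj_ofReal]
    rw [hT]
    push_cast
    field_simp
    ring
  have h3 : 2 * I * ((ω / Real.pi : ℝ) : ℂ) *
      segLaplace a (a + T) (I * ((2 * k + 1 : ℕ) * ω : ℝ)) f *
        exp (I * ((2 * k + 1 : ℕ) * ω : ℝ) * a) = 2 * I * w := by
    rw [hw, hcoef]
    push_cast
    ring
  rw [add_mul, h1, h2, h3]
  simp
  ring

/-! ### Action of the blocks on odd harmonics. -/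

section Blocks

variable {a b : ℝ}

theorem eq_inv_mulVec {d : ℕ} {M : Matrix (Fin d) (Fin d) ℂ} (hM : M.det ≠ 0) {v w : Fin d → ℂ}
    (h : M *ᵥ v = w) : v = M⁻¹ *ᵥ w := by
  rw [← h, mulVec_mulVec, nonsing_inv_mul _ (isUnit_iff_ne_zero.2 hM), one_mulVec]

theorem LTI.Responds.segCont_state {G : LTI} {J : Set ℝ} {u y : ℝ → ℝ} {x : ℝ → Fin G.dim → ℝ}
    (h : G.Responds univ J u x y) (hab : a < b) : SegCont a b x :=
  .of_continuousOn hab (h.1.mono (subset_univ _))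

theorem LTI.Responds.segCont_output {G : LTI} {J : Set ℝ} {u y : ℝ → ℝ} {x : ℝ → Fin G.dim → ℝ}
    (h : G.Responds univ J u x y) (hab : a < b) (hu : SegCont a b u) : SegCont a b y :=
  (((h.segCont_state hab).dotProduct G.C).add (hu.const_mul G.D)).congr hab
    fun t _ => h.2.2 t (mem_univ t)

/-- A block with antiperiodic state acts on the harmonics by its frequency response. -/
theorem LTI.Responds.segLaplace_output {G : LTI} {J : Set ℝ} {u y : ℝ → ℝ}
    {x : ℝ → Fin G.dim → ℝ} (h : G.Responds univ J u x y) (hab : a < b)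
    (hJ : ∀ t ∈ Ioo a b, t ∉ J) (hu : SegCont a b u) (hx : x b = -x a) {ν : ℝ}
    (hs : exp (-(I * ν * b)) = -exp (-(I * ν * a))) (hdet : (pencil G.A ν).det ≠ 0) :
    segLaplace a b (I * ν) y = G.freq ν * segLaplace a b (I * ν) u := by
  have hS := h.segCont_state hab
  have h1 := pencil_mulVec_segLaplace hab ν hs G.A G.B hu hS.1
    ((h.1.continuousAt univ_mem).tendsto.mono_left nhdsWithin_le_nhds)
    fun t ht => h.2.1 t ⟨mem_univ t, hJ t ht⟩
  have h2 := eq_inv_mulVec hdet h1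
  rw [segLaplace_congr _ hab fun t _ => h.2.2 t (mem_univ t),
    segLaplace_add _ hab (hS.dotProduct _) (hu.const_mul _), segLaplace_const_mul,
    segLaplace_dotProduct _ hab _ hS, h2, LTI.freq]
  have h3 : (fun i => segLaplace a b (I * ν) u * G.B i + exp (-(I * ν * a)) * (x a i + x b i : ℝ)) =
      segLaplace a b (I * ν) u • fun i => (G.B i : ℂ) := by
    ext i
    simp [hx]
  rw [h3, mulVec_smul, dotProduct_smul, smul_eq_mul]
  ring

theorem ResetController.Responds.segCont_state {R : ResetController} {J : Set ℝ} {z m : ℝ → ℝ}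
    {x : ℝ → Fin (R.k + 1) → ℝ} (h : R.Responds univ J z x m)
    (hJ : ∀ t ∈ Ioo a b, t ∉ J) (ha : a ∈ J) (hb : b ∈ J) : SegCont a b x := by
  refine ⟨fun t ht => ?_, _, (h.2.1 a ⟨mem_univ a, ha⟩).2⟩
  rcases ht.2.lt_or_eq with hlt | rfl
  · exact (h.1 t ⟨mem_univ t, hJ t ⟨ht.1, hlt⟩⟩).continuousAt.continuousWithinAt
  · have h1 : ContinuousWithinAt x (Iio t) t := (h.2.1 t ⟨mem_univ t, hb⟩).1
    exact (continuousWithinAt_Iio_iff_Iic.1 h1).mono Ioc_subset_Iic_self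

theorem ResetController.Responds.segCont_output {R : ResetController} {J : Set ℝ} {z m : ℝ → ℝ}
    {x : ℝ → Fin (R.k + 1) → ℝ} (h : R.Responds univ J z x m) (hab : a < b)
    (hJ : ∀ t ∈ Ioo a b, t ∉ J) (ha : a ∈ J) (hb : b ∈ J) (hz : SegCont a b z) :
    SegCont a b m :=
  (((h.segCont_state hJ ha hb).dotProduct R.C).add (hz.const_mul R.D)).congr hab
    fun t _ => h.2.2 t (mem_univ t)

/-- The harmonics of the output of a reset controller with antiperiodic state: the base-linear
response and the contribution of the jumps. -/
theorem ResetController.Responds.segLaplace_output {R : ResetController} {J : Set ℝ} {z m : ℝ → ℝ}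
    {x : ℝ → Fin (R.k + 1) → ℝ} (h : R.Responds univ J z x m) (hab : a < b)
    (hJ : ∀ t ∈ Ioo a b, t ∉ J) (ha : a ∈ J) (hb : b ∈ J) (hz : SegCont a b z)
    (hx : x b = -x a) {ν : ℝ} (hs : exp (-(I * ν * b)) = -exp (-(I * ν * a)))
    (hdet : (pencil R.A ν).det ≠ 0) :
    segLaplace a b (I * ν) m = R.base.freq ν * segLaplace a b (I * ν) z +
      exp (-(I * ν * a)) * ((fun i => (R.C i : ℂ)) ⬝ᵥ
        ((pencil R.A ν)⁻¹ *ᵥ fun i => (((R.Aρ - 1) *ᵥ x a) i : ℂ))) := by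
  have hS := h.segCont_state hJ ha hb
  have h1 := pencil_mulVec_segLaplace hab ν hs R.A R.B hz hS.1
    (h.2.1 a ⟨mem_univ a, ha⟩).2 fun t ht => h.1 t ⟨mem_univ t, hJ t ht⟩
  have h2 := eq_inv_mulVec hdet h1
  rw [segLaplace_congr _ hab fun t _ => h.2.2 t (mem_univ t),
    segLaplace_add _ hab (hS.dotProduct _) (hz.const_mul _), segLaplace_const_mul,
    segLaplace_dotProduct _ hab _ hS, h2]
  have hfreq : R.base.freq ν =
      (fun i => (R.C i : ℂ)) ⬝ᵥ ((pencil R.A ν)⁻¹ *ᵥ fun i => (R.B i : ℂ)) + R.D := rfl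
  -- The boundary term is the state after the reset at `a` plus `x b = -x a`, which is the jump at
  -- `a`.
  have h3 : (fun i => segLaplace a b (I * ν) z * R.B i +
      exp (-(I * ν * a)) * ((R.Aρ *ᵥ x a) i + x b i : ℝ)) =
      segLaplace a b (I * ν) z • (fun i => (R.B i : ℂ)) +
        exp (-(I * ν * a)) • fun i => (((R.Aρ - 1) *ᵥ x a) i : ℂ) := by
    ext i
    simp only [hx, sub_mulVec, one_mulVec, Pi.add_apply, Pi.smul_apply, Pi.neg_apply, Pi.sub_apply,
      smul_eq_mul, ofReal_add, ofReal_sub, ofReal_neg]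
    ring
  rw [h3, mulVec_add, mulVec_smul, mulVec_smul, dotProduct_add, dotProduct_smul, dotProduct_smul,
    smul_eq_mul, smul_eq_mul, hfreq]
  ring

end Blocks

/-! ### Free motions and the size of the jump. -/

section MatrixExp

open scoped Matrix.Norms.Operator

theorem hasDerivAt_exp_mulVec {d : ℕ} (A : Matrix (Fin d) (Fin d) ℝ) (g : Fin d → ℝ) (a t : ℝ) :
    HasDerivAt (fun t : ℝ => NormedSpace.exp ((t - a) • A) *ᵥ g)
      (A *ᵥ (NormedSpace.exp ((t - a) • A) *ᵥ g)) t := by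
  have h1 := (hasDerivAt_exp_smul_const' (𝕂 := ℝ) A (t - a)).comp_sub_const t a
  let L : Matrix (Fin d) (Fin d) ℝ →L[ℝ] (Fin d → ℝ) :=
    LinearMap.toContinuousLinearMap ((mulVecBilin ℝ ℝ).flip g)
  have h2 := L.hasFDerivAt.comp_hasDerivAt t h1
  rw [mulVec_mulVec]
  exact h2

end MatrixExp

/-- `I + exp (A π / ω)` is invertible if `A` has no eigenvalue at an odd multiple of `j ω`. -/
theorem det_one_add_exp_ne_zero {d : ℕ} (A : Matrix (Fin d) (Fin d) ℝ) {ω : ℝ} (hω : 0 < ω)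
    (hA : ∀ n : ℕ, Odd n → (pencil A (n * ω)).det ≠ 0) :
    (1 + NormedSpace.exp ((Real.pi / ω) • A)).det ≠ 0 := by
  intro hdet
  obtain ⟨g, hg0, hg⟩ := exists_mulVec_eq_zero_iff.2 hdet
  apply hg0
  -- A kernel vector `g` starts a free motion that is antiperiodic. The invertible pencils kill all
  -- its odd harmonics, so its Fourier series at `0` sums to `g = 0`.
  set x : ℝ → Fin d → ℝ := fun t => NormedSpace.exp ((t - 0) • A) *ᵥ g with hx
  have hder (t : ℝ) : HasDerivAt x (A *ᵥ x t) t := hasDerivAt_exp_mulVec A g 0 t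
  have hcont : Continuous x := continuous_iff_continuousAt.2 fun t => (hder t).continuousAt
  have hpos : 0 < Real.pi / ω := by positivity
  have hx0 : x 0 = g := by simp [hx]
  have hend : x (0 + Real.pi / ω) = -x 0 := by
    rw [hx0, hx]
    rw [add_mulVec, one_mulVec] at hg
    simpa using (eq_neg_of_add_eq_zero_right hg)
  have hzero (n : ℕ) (hn : Odd n) (i : Fin d) :
      segLaplace 0 (0 + Real.pi / ω) (I * (n * ω : ℝ)) (fun t => x t i) = 0 := by
    have h1 := pencil_mulVec_segLaplace (a := 0) (b := 0 + Real.pi / ω) (by linarith) (n * ω)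
      (by rw [exp_I_mul_add_pi_div n hω, hn.neg_one_pow]; simp) A (fun _ => 0) (u := fun _ => 0)
      (x := x) (l := x 0) (.of_continuousOn (by linarith) continuousOn_const) hcont.continuousOn
      (hcont.continuousAt.tendsto.mono_left nhdsWithin_le_nhds)
      (fun t _ => by simpa using! hder t)
    have h2 := congrFun (eq_inv_mulVec (hA n hn) h1) i
    rw [h2, hend]
    simp only [Pi.neg_apply, add_neg_cancel, ofReal_zero, mul_zero, add_zero]
    exact congrFun (mulVec_zero _) i
  ext i
  have h := hasSum_odd_harmonics (a := 0) hω (f := fun t => x t i)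
    ((continuous_apply i).comp hcont).continuousOn (congrFun hend i) (by
      simp_rw [hzero _ ⟨_, rfl⟩]; exact summable_zero)
  simp_rw [hzero _ ⟨_, rfl⟩] at h
  simp only [mul_zero, zero_mul, zero_im] at h
  have h' := h.unique hasSum_zero
  rw [hx0] at h'
  exact h'

/-- The value `v` at the reset instant `a` of the steady-state base-linear response to `z`
determines the jump of the reset controller; its Fourier coefficients are `Δ_l(nω) Zⁿ`. -/
theorem ResetController.Responds.exists_baseLinear {R : ResetController} {J : Set ℝ}
    {z m : ℝ → ℝ} {x : ℝ → Fin (R.k + 1) → ℝ} {ω a : ℝ} (hω : 0 < ω)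
    (h : R.Responds univ J z x m) (hJ : ∀ t ∈ Ioo a (a + Real.pi / ω), t ∉ J) (ha : a ∈ J)
    (hb : a + Real.pi / ω ∈ J) (hz : SegCont a (a + Real.pi / ω) z)
    (hx : x (a + Real.pi / ω) = -x a)
    (hA : ∀ n : ℕ, Odd n → (pencil R.A (n * ω)).det ≠ 0)
    (hdet : (R.Aρ * R.expHalf ω + 1).det ≠ 0) :
    ∃ v : Fin (R.k + 1) → ℝ,
      (R.Aρ - 1) *ᵥ x a =
        ((1 + R.expHalf ω) * (R.Aρ * R.expHalf ω + 1)⁻¹ * (R.Aρ - 1)) *ᵥ v ∧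
      ∀ i, (Summable fun k : ℕ => R.Δl ((2 * k + 1 : ℕ) * ω) i *
          segLaplace a (a + Real.pi / ω) (I * ((2 * k + 1 : ℕ) * ω : ℝ)) z) →
        HasSum (fun k : ℕ => (2 * I * ((ω / Real.pi : ℝ) : ℂ) * (R.Δl ((2 * k + 1 : ℕ) * ω) i *
          segLaplace a (a + Real.pi / ω) (I * ((2 * k + 1 : ℕ) * ω : ℝ)) z) *
            exp (I * ((2 * k + 1 : ℕ) * ω : ℝ) * a)).im) (v i) := by
  set b := a + Real.pi / ω with hbdef
  have hpos : 0 < Real.pi / ω := by positivity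
  have hab : a < b := by linarith
  set E := R.expHalf ω with hE
  set p := (R.Aρ - 1) *ᵥ x a with hp
  have hdetE : IsUnit (1 + E).det := (det_one_add_exp_ne_zero R.A hω hA).isUnit
  -- Subtracting the free motion from `g` leaves `F`, with right limit `v = A_ρ x(a) - g` at `a` and
  -- `F b = -x(a) - E g`. The requirement `F b = -v` is exactly `(1 + E) g = p`; then `F` is the
  -- jump-free antiperiodic response to `z`.
  set g := (1 + E)⁻¹ *ᵥ p with hg
  have hg' : g + E *ᵥ g = p := by
    have h1 : (1 + E) *ᵥ g = p := by rw [hg, mulVec_mulVec, mul_nonsing_inv _ hdetE, one_mulVec]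
    rwa [add_mulVec, one_mulVec] at h1
  have hpx : R.Aρ *ᵥ x a = p + x a := by rw [hp, sub_mulVec, one_mulVec]; simp
  set F : ℝ → Fin (R.k + 1) → ℝ := fun t => x t - NormedSpace.exp ((t - a) • R.A) *ᵥ g with hF
  set v := R.Aρ *ᵥ x a - g with hv
  have hS := h.segCont_state hJ ha hb
  have hcont : Continuous fun t : ℝ => NormedSpace.exp ((t - a) • R.A) *ᵥ g :=
    continuous_iff_continuousAt.2 fun t => (hasDerivAt_exp_mulVec R.A g a t).continuousAt
  have hFc : ContinuousOn F (Ioc a b) := hS.1.sub hcont.continuousOn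
  have hFl : Tendsto F (𝓝[>] a) (𝓝 v) := by
    refine (h.2.1 a ⟨mem_univ a, ha⟩).2.sub ?_
    have := hcont.continuousAt (x := a) |>.tendsto.mono_left (nhdsWithin_le_nhds (s := Ioi a))
    simpa using this
  have hFb : F b = -v := by
    have h1 : F b = x b - E *ᵥ g := by simp only [hF, hbdef, add_sub_cancel_left]; rfl
    rw [h1, hx, hv, hpx, ← hg']
    abel
  have hfourier (n : ℕ) (hn : Odd n) (i : Fin (R.k + 1)) :
      segLaplace a b (I * (n * ω : ℝ)) (fun t => F t i) =
        R.Δl (n * ω) i * segLaplace a b (I * (n * ω : ℝ)) z := by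
    have h1 := pencil_mulVec_segLaplace hab (n * ω)
      (by rw [hbdef, exp_I_mul_add_pi_div n hω, hn.neg_one_pow]; simp) R.A R.B hz hFc hFl
      (fun t ht => by
        convert! (h.1 t ⟨mem_univ t, hJ t ht⟩).sub (hasDerivAt_exp_mulVec R.A g a t) using 1
        rw [hF, mulVec_sub]
        abel)
    have h2 := congrFun (eq_inv_mulVec (hA n hn) h1) i
    have h3 : (fun i => segLaplace a b (I * (n * ω : ℝ)) z * R.B i +
        exp (-(I * (n * ω : ℝ) * a)) * (v i + F b i : ℝ)) =
        segLaplace a b (I * (n * ω : ℝ)) z • fun i => (R.B i : ℂ) := by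
      ext i
      simp [hFb]
    rw [h2, h3, mulVec_smul, Pi.smul_apply, smul_eq_mul, mul_comm]
    rfl
  refine ⟨v, ?_, fun i hsum => ?_⟩
  -- Since `v = x(a) + E g`, the right side is `p + A_ρ E g - E g`, and `p - E g = g`.
  · have h1 : (R.Aρ * E + 1) *ᵥ g = (R.Aρ - 1) *ᵥ v := by
      have h2 : E *ᵥ g = p - g := by rw [← hg']; abel
      rw [add_mulVec, ← mulVec_mulVec, h2, hv, sub_mulVec, mulVec_sub, mulVec_sub, one_mulVec,
        one_mulVec, hpx, mulVec_add, hpx]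
      abel
    have h3 : g = (R.Aρ * E + 1)⁻¹ *ᵥ ((R.Aρ - 1) *ᵥ v) := by
      rw [← h1, mulVec_mulVec, nonsing_inv_mul _ hdet.isUnit, one_mulVec]
    rw [← mulVec_mulVec, ← mulVec_mulVec, ← h3, add_mulVec, one_mulVec, hg']
  -- At `a` itself `x` still has its value before the reset; replacing the value of `F` there by its
  -- right limit gives continuity on `[a, b]` and leaves the integrals unchanged.
  · have hup (t : ℝ) (ht : t ∈ Ioc a b) : Function.update F a v t i = F t i := by
      rw [Function.update_of_ne ht.1.ne']
    have hseg (n : ℕ) (hn : Odd n) : segLaplace a b (I * (n * ω : ℝ))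
        (fun t => Function.update F a v t i) =
          R.Δl (n * ω) i * segLaplace a b (I * (n * ω : ℝ)) z := by
      rw [segLaplace_congr _ hab hup, hfourier n hn]
    have := hasSum_odd_harmonics (a := a) hω (f := fun t => Function.update F a v t i)
      (continuousOn_pi.1 (SegCont.continuousOn_update hFc hFl) i)
      (by
        change Function.update F a v b i = -Function.update F a v a i
        rw [hup b (right_mem_Ioc.2 hab), hFb, Function.update_self]
        rfl)
      (by
        refine hsum.congr fun k => ?_
        exact (hseg _ ⟨k, rfl⟩).symm)
    rw [Function.update_self] at this
    refine this.congr_fun fun k => ?_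
    rw [← hseg _ ⟨k, rfl⟩]

theorem ResetController.Aρ_sub_one_mulVec (R : ResetController) (v : Fin (R.k + 1) → ℝ) :
    (R.Aρ - 1) *ᵥ v = Pi.single 0 ((R.γ - 1) * v 0) := by
  ext i
  rw [sub_mulVec, one_mulVec, ResetController.Aρ, Pi.sub_apply, mulVec_diagonal]
  refine Fin.cases ?_ (fun j => ?_) i
  · simp; ring
  · simp

/-- The jump of the reset controller is a multiple of `Δ_q(ω)`. -/
theorem ResetLoop.jump_eq_smul_Δq (S : ResetLoop) {ω : ℝ} (hΔ : S.Δc ω 0 ≠ 0)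
    (v : Fin (S.Cr.k + 1) → ℝ) :
    ((1 + S.Cr.expHalf ω) * (S.Cr.Aρ * S.Cr.expHalf ω + 1)⁻¹ * (S.Cr.Aρ - 1)) *ᵥ v =
      (v 0 / S.Δc ω 0) • S.Δq ω := by
  -- Only the reset component survives `A_ρ - 1`, so `v` may be replaced by the multiple of `Δ_c`
  -- with the same component `0`.
  have h : (S.Cr.Aρ - 1) *ᵥ v = (v 0 / S.Δc ω 0) • ((S.Cr.Aρ - 1) *ᵥ S.Δc ω) := by
    rw [S.Cr.Aρ_sub_one_mulVec, S.Cr.Aρ_sub_one_mulVec, ← Pi.single_smul]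
    congr 1
    simp only [smul_eq_mul]
    field_simp
  rw [ResetLoop.Δq, ← mulVec_mulVec, h, mulVec_smul, mulVec_mulVec]

/-! ### Linearity for fixed reset instants, and half-wave symmetry. -/

theorem Function.Periodic.eq_zero_of_tendsto {E : Type*} [TopologicalSpace E] [T2Space E] [Zero E]
    {f : ℝ → E} {T : ℝ} (hf : Function.Periodic f T) (hT : 0 < T) (h : Tendsto f atTop (𝓝 0))
    (t : ℝ) : f t = 0 := by
  have h1 : Tendsto (fun n : ℕ => t + n * T) atTop atTop :=
    tendsto_atTop_add_const_left _ _ (tendsto_natCast_atTop_atTop.atTop_mul_const hT)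
  have h2 := h.comp h1
  have h3 : (f ∘ fun n : ℕ => t + n * T) = fun _ => f t := funext fun n => hf.nat_mul n t
  rw [h3] at h2
  exact tendsto_nhds_unique tendsto_const_nhds h2

namespace LTI

variable {G : LTI} {T T' J : Set ℝ} {u u' y y' : ℝ → ℝ} {x x' : ℝ → Fin G.dim → ℝ}

theorem Responds.mono (h : G.Responds T J u x y) (hT : T' ⊆ T) : G.Responds T' J u x y :=
  ⟨h.1.mono hT, fun t ht => h.2.1 t ⟨hT ht.1, ht.2⟩, fun t ht => h.2.2 t (hT ht)⟩

theorem Responds.add (h : G.Responds T J u x y) (h' : G.Responds T J u' x' y') :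
    G.Responds T J (fun t => u t + u' t) (fun t => x t + x' t) (fun t => y t + y' t) := by
  refine ⟨h.1.add h'.1, fun t ht => ?_, fun t ht => ?_⟩
  · convert! (h.2.1 t ht).add (h'.2.1 t ht) using 1
    rw [mulVec_add, add_smul]
    abel
  · simp only [h.2.2 t ht, h'.2.2 t ht, dotProduct_add]
    ring

theorem Responds.neg_shift (h : G.Responds univ J u x y) {c : ℝ} (hJ : ∀ t ∉ J, t + c ∉ J) :
    G.Responds univ J (fun t => -u (t + c)) (fun t => -x (t + c)) (fun t => -y (t + c)) := by
  refine ⟨?_, fun t ht => ?_, fun t _ => ?_⟩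
  · have := continuousOn_univ.1 h.1
    exact (by fun_prop : Continuous fun t => -x (t + c)).continuousOn
  · convert! ((h.2.1 (t + c) ⟨mem_univ _, hJ t ht.2⟩).comp_add_const t c).neg using 1
    rw [mulVec_neg, neg_smul]
    abel
  · simp only [h.2.2 (t + c) (mem_univ _), dotProduct_neg]
    ring

end LTI

namespace ResetController

variable {R : ResetController} {T T' J : Set ℝ} {z z' m m' : ℝ → ℝ} {x x' : ℝ → Fin (R.k + 1) → ℝ}

theorem Responds.mono (h : R.Responds T J z x m) (hT : T' ⊆ T) : R.Responds T' J z x m :=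
  ⟨fun t ht => h.1 t ⟨hT ht.1, ht.2⟩, fun t ht => h.2.1 t ⟨hT ht.1, ht.2⟩,
    fun t ht => h.2.2 t (hT ht)⟩

theorem Responds.add (h : R.Responds T J z x m) (h' : R.Responds T J z' x' m') :
    R.Responds T J (fun t => z t + z' t) (fun t => x t + x' t) (fun t => m t + m' t) := by
  refine ⟨fun t ht => ?_, fun t ht => ⟨?_, ?_⟩, fun t ht => ?_⟩
  · convert! (h.1 t ht).add (h'.1 t ht) using 1
    rw [mulVec_add, add_smul]
    abel
  · exact (h.2.1 t ht).1.add (h'.2.1 t ht).1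
  · rw [mulVec_add]
    exact (h.2.1 t ht).2.add (h'.2.1 t ht).2
  · simp only [h.2.2 t ht, h'.2.2 t ht, dotProduct_add]
    ring

theorem Responds.neg_shift (h : R.Responds univ J z x m) {c : ℝ} (hJ : ∀ t, t + c ∈ J ↔ t ∈ J) :
    R.Responds univ J (fun t => -z (t + c)) (fun t => -x (t + c)) (fun t => -m (t + c)) := by
  refine ⟨fun t ht => ?_, fun t ht => ⟨?_, ?_⟩, fun t _ => ?_⟩
  · convert! ((h.1 (t + c) ⟨mem_univ _, mt (hJ t).1 ht.2⟩).comp_add_const t c).neg using 1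
    rw [mulVec_neg, neg_smul]
    abel
  · refine ((h.2.1 (t + c) ⟨mem_univ _, (hJ t).2 ht.2⟩).1.comp ?_).neg
    refine tendsto_nhdsWithin_iff.2 ⟨?_, ?_⟩
    · exact ((continuous_add_const c).tendsto t).mono_left nhdsWithin_le_nhds
    · filter_upwards [self_mem_nhdsWithin] with s hs using by simpa using hs
  · rw [mulVec_neg]
    refine ((h.2.1 (t + c) ⟨mem_univ _, (hJ t).2 ht.2⟩).2.comp ?_).neg
    refine tendsto_nhdsWithin_iff.2 ⟨?_, ?_⟩
    · exact ((continuous_add_const c).tendsto t).mono_left nhdsWithin_le_nhds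
    · filter_upwards [self_mem_nhdsWithin] with s hs using by simpa using hs
  · simp only [h.2.2 (t + c) (mem_univ _), dotProduct_neg]
    ring

end ResetController

namespace ResetLoop

variable {S : ResetLoop} {T T' J : Set ℝ} {r r' d d' : ℝ → ℝ} {X X' : S.Trajectory}

/-- The sum of two trajectories. -/
def Trajectory.add (X X' : S.Trajectory) : S.Trajectory where
  xr t := X.xr t + X'.xr t
  x1 t := X.x1 t + X'.x1 t
  x2 t := X.x2 t + X'.x2 t
  x3 t := X.x3 t + X'.x3 t
  x4 t := X.x4 t + X'.x4 t
  xs t := X.xs t + X'.xs t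
  xP t := X.xP t + X'.xP t
  e t := X.e t + X'.e t
  z t := X.z t + X'.z t
  zs t := X.zs t + X'.zs t
  m t := X.m t + X'.m t
  a t := X.a t + X'.a t
  u t := X.u t + X'.u t
  y t := X.y t + X'.y t
  f t := X.f t + X'.f t

/-- The trajectory `-X (t + c)`. -/
def Trajectory.negShift (X : S.Trajectory) (c : ℝ) : S.Trajectory where
  xr t := -X.xr (t + c)
  x1 t := -X.x1 (t + c)
  x2 t := -X.x2 (t + c)
  x3 t := -X.x3 (t + c)
  x4 t := -X.x4 (t + c)
  xs t := -X.xs (t + c)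
  xP t := -X.xP (t + c)
  e t := -X.e (t + c)
  z t := -X.z (t + c)
  zs t := -X.zs (t + c)
  m t := -X.m (t + c)
  a t := -X.a (t + c)
  u t := -X.u (t + c)
  y t := -X.y (t + c)
  f t := -X.f (t + c)

theorem IsResponse.mono (h : S.IsResponse T J r d X) (hT : T' ⊆ T) : S.IsResponse T' J r d X where
  c1 := h.c1.mono hT
  cs := h.cs.mono hT
  cr := h.cr.mono hT
  c2 := h.c2.mono hT
  c3 := h.c3.mono hT
  p := h.p.mono hT
  c4 := h.c4.mono hT
  err t ht := h.err t (hT ht)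

/-- Superposition is available because `J` is prescribed here and not recomputed from each
trajectory. -/
theorem IsResponse.add (h : S.IsResponse T J r d X) (h' : S.IsResponse T J r' d' X') :
    S.IsResponse T J (fun t => r t + r' t) (fun t => d t + d' t) (X.add X') where
  c1 := h.c1.add h'.c1
  cs := h.cs.add h'.cs
  cr := h.cr.add h'.cr
  c2 := h.c2.add h'.c2
  c3 := by simpa only [Trajectory.add, add_add_add_comm] using h.c3.add h'.c3
  p := by simpa only [Trajectory.add, add_add_add_comm] using h.p.add h'.p
  c4 := h.c4.add h'.c4
  err t ht := by simp only [Trajectory.add, h.err t ht, h'.err t ht]; ring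

theorem IsResponse.negShift (h : S.IsResponse univ J r d X) {c : ℝ}
    (hJ : ∀ t, t + c ∈ J ↔ t ∈ J) :
    S.IsResponse univ J (fun t => -r (t + c)) (fun t => -d (t + c)) (X.negShift c) where
  c1 := h.c1.neg_shift fun t => mt (hJ t).1
  cs := h.cs.neg_shift fun t => mt (hJ t).1
  cr := h.cr.neg_shift hJ
  c2 := h.c2.neg_shift fun t => mt (hJ t).1
  c3 := by simpa only [Trajectory.negShift, neg_add] using h.c3.neg_shift fun t => mt (hJ t).1
  p := by simpa only [Trajectory.negShift, neg_add] using h.p.neg_shift fun t => mt (hJ t).1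
  c4 := h.c4.neg_shift fun t => mt (hJ t).1
  err t _ := by simp only [Trajectory.negShift, h.err (t + c) (mem_univ _)]; ring

/-- The solution of the algebraic loop: the error as a function of the states and the inputs. -/
theorem IsResponse.error_eq (hwp : S.WellPosed) (h : S.IsResponse T J r d X) {t : ℝ} (ht : t ∈ T) :
    X.e t = (1 + (S.Cr.D + S.C2.D) * S.C3.D * S.P.D * S.C4.D * S.C1.D)⁻¹ *
      (r t + -(S.C4.C ⬝ᵥ X.x4 t + S.C4.D * (S.P.C ⬝ᵥ X.xP t + S.P.D * (S.C3.C ⬝ᵥ X.x3 t +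
        S.C3.D * (S.Cr.C ⬝ᵥ X.xr t + (S.C2.C ⬝ᵥ X.x2 t +
          (S.Cr.D + S.C2.D) * S.C1.C ⬝ᵥ X.x1 t)) + d t)))) := by
  rw [eq_inv_mul_iff_mul_eq₀ hwp]
  have h1 := h.c1.2.2 t ht
  have h2 := h.c2.2.2 t ht
  have h3 := h.c3.2.2 t ht
  have h4 := h.c4.2.2 t ht
  have h5 := h.p.2.2 t ht
  have h6 := h.cr.2.2 t ht
  have h7 := h.err t ht
  beta_reduce at h3 h5
  rw [h4, h5, h3, h6, h2, h1] at h7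
  linear_combination h7

/-- The steady state has half-wave symmetry. -/
theorem IsTwoResetSteadyState.state_antiperiodic {ω : ℝ} (hω : 0 < ω)
    (hr : Function.Antiperiodic r (Real.pi / ω)) (hd : Function.Antiperiodic d (Real.pi / ω))
    (hX : S.IsTwoResetSteadyState ω r d X)
    (hJ : ∀ t, t + Real.pi / ω ∈ resetInstants ω X ↔ t ∈ resetInstants ω X)
    (hconv : S.IsConvergent (resetInstants ω X) r d) :
    Function.Antiperiodic X.state (Real.pi / ω) := by
  have h1 := hX.response.negShift hJ
  have hr' : (fun t => -r (t + Real.pi / ω)) = r := funext fun t => by rw [hr t, neg_neg]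
  have hd' : (fun t => -d (t + Real.pi / ω)) = d := funext fun t => by rw [hd t, neg_neg]
  rw [hr', hd'] at h1
  -- Both trajectories answer the same inputs, so the difference of their states tends to zero;
  -- being periodic, it is zero.
  have h2 := hconv X (X.negShift (Real.pi / ω)) (hX.response.mono (subset_univ _))
    (h1.mono (subset_univ _))
  have h3 (t : ℝ) : (X.negShift (Real.pi / ω)).state t = -X.state (t + Real.pi / ω) := rfl
  simp only [h3, sub_neg_eq_add] at h2
  have hper : Function.Periodic (fun t => X.state t + X.state (t + Real.pi / ω))
      (2 * Real.pi / ω) := fun t => by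
    simp only
    rw [hX.periodic t, add_right_comm, hX.periodic]
  intro t
  exact eq_neg_of_add_eq_zero_right (hper.eq_zero_of_tendsto (by positivity) h2 t)

end ResetLoop

/-! ### Sinusoidal responses and the non-vanishing of `1 + L_l`. -/

/-- The sinusoid of angular frequency `ν` with complex amplitude `c`. -/
def phasor (ν : ℝ) (c : ℂ) (t : ℝ) : ℝ := (c * exp (I * ν * t)).re

theorem phasor_add (ν : ℝ) (c c' : ℂ) (t : ℝ) :
    phasor ν (c + c') t = phasor ν c t + phasor ν c' t := by simp [phasor, add_mul]

theorem phasor_ofReal_mul (ν r : ℝ) (c : ℂ) (t : ℝ) : phasor ν (r * c) t = r * phasor ν c t := by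
  rw [phasor, mul_assoc, re_ofReal_mul, phasor]

theorem phasor_dotProduct {d : ℕ} (ν : ℝ) (C : Fin d → ℝ) (w : Fin d → ℂ) (t : ℝ) :
    phasor ν ((fun i => (C i : ℂ)) ⬝ᵥ w) t = C ⬝ᵥ fun i => phasor ν (w i) t := by
  simp only [dotProduct, ← phasor_ofReal_mul]
  simp [phasor, Finset.sum_mul]

theorem hasDerivAt_phasor (ν : ℝ) (c : ℂ) (t : ℝ) :
    HasDerivAt (phasor ν c) (phasor ν (I * ν * c) t) t := by
  have h1 : HasDerivAt (fun t : ℝ => exp (I * ν * t)) (exp (I * ν * t) * (I * ν * 1)) t :=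
    (((hasDerivAt_id (t : ℂ)).const_mul (I * (ν : ℂ))).cexp).comp_ofReal
  have h2 := reCLM.hasFDerivAt.comp_hasDerivAt t (h1.const_mul c)
  convert! h2 using 1
  simp only [phasor, reCLM_apply]
  ring_nf

theorem phasor_periodic {ν : ℝ} (hν : 0 < ν) (c : ℂ) :
    Function.Periodic (phasor ν c) (2 * Real.pi / ν) := fun t => by
  have hν' : (ν : ℂ) ≠ 0 := by exact_mod_cast hν.ne'
  have h : I * ν * ((t + 2 * Real.pi / ν : ℝ) : ℂ) = I * ν * t + 2 * Real.pi * I := by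
    push_cast
    field_simp
  rw [phasor, h, exp_add, exp_two_pi_mul_I, mul_one, phasor]

theorem eq_zero_of_phasor_eq_zero {ν : ℝ} (hν : 0 < ν) {c : ℂ} (h : ∀ t, phasor ν c t = 0) :
    c = 0 := by
  have hν' : (ν : ℂ) ≠ 0 := by exact_mod_cast hν.ne'
  apply Complex.ext
  · simpa [phasor] using h 0
  · have h1 := h (Real.pi / 2 / ν)
    have h2 : I * ν * ((Real.pi / 2 / ν : ℝ) : ℂ) = Real.pi / 2 * I := by
      push_cast
      field_simp
    rw [phasor, h2, exp_pi_div_two_mul_I] at h1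
    simpa using h1

/-- The sinusoidal response of a block. -/
theorem LTI.responds_phasor (G : LTI) {ν : ℝ} (hdet : (pencil G.A ν).det ≠ 0) (J : Set ℝ) (c : ℂ) :
    G.Responds univ J (phasor ν c)
      (fun t i => phasor ν (((pencil G.A ν)⁻¹ *ᵥ fun i => (G.B i : ℂ)) i * c) t)
      (phasor ν (G.freq ν * c)) := by
  set w := (pencil G.A ν)⁻¹ *ᵥ fun i => (G.B i : ℂ) with hw
  have hw' (i : Fin G.dim) :
      I * ν * w i = (fun j => (G.A i j : ℂ)) ⬝ᵥ w + G.B i := by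
    have h1 : pencil G.A ν *ᵥ w = fun i => (G.B i : ℂ) := by
      rw [hw, mulVec_mulVec, mul_nonsing_inv _ hdet.isUnit, one_mulVec]
    have h2 := congrFun h1 i
    rw [pencil, sub_mulVec, smul_mulVec, one_mulVec] at h2
    simp only [Pi.sub_apply, Pi.smul_apply, smul_eq_mul, mulVec, Matrix.map_apply] at h2
    rw [← h2]
    ring
  have hder (t : ℝ) : HasDerivAt (fun t i => phasor ν (w i * c) t)
      (G.A *ᵥ (fun i => phasor ν (w i * c) t) + phasor ν c t • G.B) t := by
    refine hasDerivAt_pi.2 fun i => ?_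
    convert! hasDerivAt_phasor ν (w i * c) t using 1
    rw [← mul_assoc, hw', add_mul, phasor_add, phasor_ofReal_mul]
    have h3 : ((fun j => (G.A i j : ℂ)) ⬝ᵥ w) * c =
        (fun j => (G.A i j : ℂ)) ⬝ᵥ fun j => w j * c := by
      simp [dotProduct, Finset.sum_mul, mul_assoc]
    rw [h3, phasor_dotProduct]
    simp [mulVec, mul_comm]
  refine ⟨fun t _ => (hder t).continuousAt.continuousWithinAt, fun t _ => hder t, fun t _ => ?_⟩
  rw [LTI.freq, add_mul, phasor_add, phasor_ofReal_mul, ← hw]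
  have h3 : ((fun j => (G.C j : ℂ)) ⬝ᵥ w) * c =
      (fun j => (G.C j : ℂ)) ⬝ᵥ fun j => w j * c := by
    simp [dotProduct, Finset.sum_mul, mul_assoc]
  rw [h3, phasor_dotProduct]

/-- Resets do nothing where the state that is reset vanishes. -/
theorem ResetController.responds_of_base {R : ResetController} {J : Set ℝ} {z m : ℝ → ℝ}
    {x : ℝ → Fin (R.k + 1) → ℝ} (h : R.base.Responds univ ∅ z x m) (hJ : ∀ t ∈ J, x t 0 = 0) :
    R.Responds univ J z x m := by
  have hder (t : ℝ) : HasDerivAt x (R.A *ᵥ x t + z t • R.B) t := h.2.1 t ⟨mem_univ t, by simp⟩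
  refine ⟨fun t _ => hder t, fun t ht => ⟨(hder t).continuousAt.tendsto.mono_left
    nhdsWithin_le_nhds, ?_⟩, h.2.2⟩
  have h1 : R.Aρ *ᵥ x t = x t := by
    have := R.Aρ_sub_one_mulVec (x t)
    rw [hJ t ht.2, mul_zero, Pi.single_zero, sub_mulVec, one_mulVec] at this
    exact sub_eq_zero.1 this
  rw [h1]
  exact (hder t).continuousAt.tendsto.mono_left nhdsWithin_le_nhds

/-- Used to choose the phase of an oscillation so that its reset state vanishes at the reset
instants: one real condition on a complex amplitude. -/
theorem exists_re_mul_eq_zero (q : ℂ) : ∃ ε : ℂ, ε ≠ 0 ∧ (q * ε).re = 0 := by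
  by_cases hq : q = 0
  · exact ⟨1, one_ne_zero, by simp [hq]⟩
  · refine ⟨I * (starRingEnd ℂ) q, by simp [hq], ?_⟩
    simp
    ring

/-- A convergent loop has no undamped base-linear oscillation that is invisible to the resets. -/
theorem ResetLoop.IsConvergent.one_add_Ll_ne_zero {S : ResetLoop} {J : Set ℝ} {r d : ℝ → ℝ}
    {X : S.Trajectory} (hconv : S.IsConvergent J r d) (hX : S.IsResponse univ J r d X)
    (hwp : S.WellPosed) {ν : ℝ} (hν : 0 < ν)
    (hdet : ∀ G ∈ [S.Cr.base, S.C1, S.C2, S.C3, S.C4, S.Cs, S.P], (pencil G.A ν).det ≠ 0)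
    {σ : ℂ} (hJ : ∀ t ∈ J, exp (I * ν * t) = σ ∨ exp (I * ν * t) = -σ) :
    1 + S.Ll ν ≠ 0 := by
  intro hL
  simp only [List.mem_cons, List.not_mem_nil, or_false, forall_eq_or_imp, forall_eq] at hdet
  obtain ⟨hr, h1, h2, h3, h4, hs, hP⟩ := hdet
  -- `ε` is the amplitude of the error in a loop oscillation with zero input. By `hJ` the reset
  -- state at any reset instant is plus or minus the real part made zero here.
  obtain ⟨ε, hε, hre⟩ := exists_re_mul_eq_zero (S.Cr.Δl ν 0 * S.C1.freq ν * σ)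
  set Z := S.C1.freq ν * ε with hZ
  set M := S.Cr.base.freq ν * Z + S.C2.freq ν * Z with hM
  set Y := S.P.freq ν * (S.C3.freq ν * M) with hY
  let st (G : LTI) (c : ℂ) (t : ℝ) (i : Fin G.dim) : ℝ :=
    phasor ν (((pencil G.A ν)⁻¹ *ᵥ fun i => (G.B i : ℂ)) i * c) t
  let V : S.Trajectory :=
    { xr := st S.Cr.base Z, x1 := st S.C1 ε, x2 := st S.C2 Z, x3 := st S.C3 M, x4 := st S.C4 Y,
      xs := st S.Cs Z, xP := st S.P (S.C3.freq ν * M), e := phasor ν ε, z := phasor ν Z,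
      zs := phasor ν (S.Cs.freq ν * Z), m := phasor ν (S.Cr.base.freq ν * Z),
      a := phasor ν (S.C2.freq ν * Z), u := phasor ν (S.C3.freq ν * M), y := phasor ν Y,
      f := phasor ν (S.C4.freq ν * Y) }
  have hV : S.IsResponse univ J (fun _ => 0) (fun _ => 0) V :=
    { c1 := S.C1.responds_phasor h1 J ε
      cs := S.Cs.responds_phasor hs J Z
      cr := by
        refine ResetController.responds_of_base (S.Cr.base.responds_phasor hr ∅ Z) fun t ht => ?_
        change phasor ν (S.Cr.Δl ν 0 * Z) t = 0
        have h5 : S.Cr.Δl ν 0 * Z * σ = S.Cr.Δl ν 0 * S.C1.freq ν * σ * ε := by rw [hZ]; ring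
        rcases hJ t ht with h | h
        · rw [phasor, h, h5, hre]
        · rw [phasor, h, mul_neg, h5, neg_re, hre, neg_zero]
      c2 := S.C2.responds_phasor h2 J Z
      c3 := by
        simp only [V, ← phasor_add]
        exact S.C3.responds_phasor h3 J M
      p := by
        simp only [V, add_zero]
        exact S.P.responds_phasor hP J _
      c4 := S.C4.responds_phasor h4 J Y
      err := fun t _ => by
        have h5 : S.C4.freq ν * Y = ((-1 : ℝ) : ℂ) * ε := by
          rw [hY, hM, hZ]
          rw [ResetLoop.Ll] at hL
          push_cast
          linear_combination ε * hL
        simp only [V]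
        rw [h5, phasor_ofReal_mul]
        ring }
  have hsum := hX.add hV
  simp only [add_zero] at hsum
  -- Convergence makes the state of `V` tend to zero, hence vanish by periodicity. Well-posedness
  -- then makes its error vanish too, against `ε ≠ 0`.
  have hlim := hconv (X.add V) X (hsum.mono (subset_univ _)) (hX.mono (subset_univ _))
  have hstate (t : ℝ) : (X.add V).state t - X.state t = V.state t := by
    have : (X.add V).state t = X.state t + V.state t := rfl
    rw [this, add_sub_cancel_left]
  simp only [hstate] at hlim
  have hst (G : LTI) (c : ℂ) (t : ℝ) : st G c (t + 2 * Real.pi / ν) = st G c t :=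
    funext fun i => phasor_periodic hν _ t
  have hper : Function.Periodic V.state (2 * Real.pi / ν) := fun t => by
    simp only [ResetLoop.Trajectory.state, V, hst]
  have hzero := hper.eq_zero_of_tendsto (by positivity) hlim
  refine hε (eq_zero_of_phasor_eq_zero hν fun t => ?_)
  have h5 := hV.error_eq hwp (mem_univ t)
  have h6 := hzero t
  simp only [ResetLoop.Trajectory.state, Prod.mk_eq_zero] at h6
  obtain ⟨e1, e2, e3, e4, e5, e6, e7⟩ := h6
  rw [e1, e2, e3, e4, e5, e7] at h5
  simpa using h5

/-! ### High-frequency decay and summability. -/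

section Asymptotics

open Asymptotics

open scoped Matrix.Norms.Operator in
-- The inverse pencil is the resolvent of `A` at `iν`, which decays like `1/|iν|`.
theorem pencil_inv_isBigO {d : ℕ} (A : Matrix (Fin d) (Fin d) ℝ) (i j : Fin d) :
    (fun ν : ℝ => (pencil A ν)⁻¹ i j) =O[atTop] fun ν => ν⁻¹ := by
  have h1 : Tendsto (fun ν : ℝ => I * (ν : ℂ)) atTop (Bornology.cobounded ℂ) := by
    rw [← tendsto_norm_atTop_iff_cobounded]
    simpa using tendsto_abs_atTop_atTop
  have h2 := (spectrum.resolvent_isBigO_inv (𝕜 := ℂ) (A.map ofReal)).comp_tendsto h1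
  have h3 : (resolvent (A.map ofReal) ∘ fun ν : ℝ => I * (ν : ℂ)) = fun ν => (pencil A ν)⁻¹ := by
    ext1 ν
    simp only [Function.comp, resolvent, pencil, nonsing_inv_eq_ringInverse,
      Algebra.algebraMap_eq_smul_one]
  rw [h3] at h2
  let L : Matrix (Fin d) (Fin d) ℂ →L[ℂ] ℂ :=
    LinearMap.toContinuousLinearMap (entryLinearMap ℂ ℂ i j)
  have h4 := (L.isBigO_comp (fun ν => (pencil A ν)⁻¹) atTop).trans h2
  refine (h4.trans (IsBigO.of_bound 1 (Eventually.of_forall fun ν => ?_)))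
  simp

theorem isBigO_dotProduct {d : ℕ} {g : ℝ → ℝ} (c : Fin d → ℂ) {v : ℝ → Fin d → ℂ}
    (h : ∀ i, (fun ν => v ν i) =O[atTop] g) : (fun ν => v ν ⬝ᵥ c) =O[atTop] g := by
  simp only [dotProduct]
  refine IsBigO.fun_sum fun i _ => ?_
  simpa only [mul_comm] using (h i).const_mul_left (c i)

theorem pencil_inv_mulVec_isBigO {d : ℕ} (A : Matrix (Fin d) (Fin d) ℝ) (c : Fin d → ℂ)
    (i : Fin d) : (fun ν : ℝ => ((pencil A ν)⁻¹ *ᵥ c) i) =O[atTop] fun ν => ν⁻¹ :=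
  isBigO_dotProduct c fun j => pencil_inv_isBigO A i j

theorem vecMul_pencil_inv_isBigO {d : ℕ} (A : Matrix (Fin d) (Fin d) ℝ) (c : Fin d → ℂ)
    (i : Fin d) : (fun ν : ℝ => (c ᵥ* (pencil A ν)⁻¹) i) =O[atTop] fun ν => ν⁻¹ := by
  simp only [vecMul, dotProduct_comm c]
  exact isBigO_dotProduct c fun j => pencil_inv_isBigO A j i

theorem LTI.tendsto_freq (G : LTI) : Tendsto G.freq atTop (𝓝 (G.D : ℂ)) := by
  have h : Tendsto (fun ν : ℝ => (fun i => (G.C i : ℂ)) ⬝ᵥ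
      ((pencil G.A ν)⁻¹ *ᵥ fun i => (G.B i : ℂ))) atTop (𝓝 0) := by
    simp_rw [dotProduct_comm (fun i => (G.C i : ℂ))]
    exact (isBigO_dotProduct _ fun i => pencil_inv_mulVec_isBigO G.A _ i).trans_tendsto
      tendsto_inv_atTop_zero
  simpa [LTI.freq] using! h.add_const (G.D : ℂ)

theorem ResetController.Δx_isBigO (R : ResetController) (i : Fin (R.k + 1)) :
    (fun ν => R.Δx ν i) =O[atTop] fun _ => (1 : ℝ) := by
  have h1 : (fun ν : ℝ => I * (ν : ℂ)) =O[atTop] fun ν => ν :=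
    IsBigO.of_bound 1 (Eventually.of_forall fun ν => by simp)
  refine (h1.mul (vecMul_pencil_inv_isBigO R.A (fun i => (R.C i : ℂ)) i)).trans ?_
  refine IsBigO.of_bound 1 (Eventually.of_forall fun ν => ?_)
  rw [norm_mul, norm_inv, norm_one, mul_one]
  exact mul_inv_le_one

theorem norm_exp_I_mul_natCast_mul (n : ℕ) (θ : ℝ) : ‖exp (I * n * θ)‖ = 1 := by
  have : I * n * θ = ((n * θ : ℝ) : ℂ) * I := by push_cast; ring
  rw [this, norm_exp_ofReal_mul_I]

theorem ResetLoop.tendsto_Ll (S : ResetLoop) :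
    Tendsto S.Ll atTop
      (𝓝 (((S.Cr.D + S.C2.D) * S.C3.D * S.P.D * S.C4.D * S.C1.D : ℝ) : ℂ)) := by
  push_cast
  exact ((((S.Cr.base.tendsto_freq.add S.C2.tendsto_freq).mul S.C3.tendsto_freq).mul
    S.P.tendsto_freq).mul S.C4.tendsto_freq).mul S.C1.tendsto_freq

/-- The terms of `Γ(ω)` are dominated by a summable sequence. -/
theorem ResetLoop.summable_Ψ_mul_Δl (S : ResetLoop) (hwp : S.WellPosed) {ω : ℝ} (hω : 0 < ω) :
    Summable fun k : ℕ => S.Ψ ω (2 * k + 3) * ‖S.Cr.Δl ((2 * k + 3 : ℕ) * ω) 0‖ := by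
  have hN : Tendsto (fun k : ℕ => ((2 * k + 3 : ℕ) : ℝ) * ω) atTop atTop := by
    refine Tendsto.atTop_mul_const hω (tendsto_natCast_atTop_atTop.comp ?_)
    exact tendsto_atTop_mono (fun k => by simp only [id]; omega) tendsto_id
  have hfreq (G : LTI) : (fun k : ℕ => G.freq ((2 * k + 3 : ℕ) * ω)) =O[atTop] fun _ => (1 : ℝ) :=
    (G.tendsto_freq.comp hN).isBigO_one ℝ
  have hC : (fun k : ℕ => S.Cρ ω (2 * k + 3)) =O[atTop] fun k => ((2 * k + 3 : ℕ) : ℝ)⁻¹ := by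
    have h1 : (fun k : ℕ => S.Cr.Δx ((2 * k + 3 : ℕ) * ω) ⬝ᵥ fun i => (S.Δq ω i : ℂ)) =O[atTop]
        fun _ => (1 : ℝ) :=
      (isBigO_dotProduct (fun i => (S.Δq ω i : ℂ)) S.Cr.Δx_isBigO).comp_tendsto hN
    have h2 : (fun k : ℕ => exp (I * (2 * k + 3 : ℕ) * arg (S.Cs.freq ω))) =O[atTop]
        fun _ => (1 : ℝ) :=
      IsBigO.of_bound 1 (Eventually.of_forall fun k => by
        rw [norm_exp_I_mul_natCast_mul]; simp)
    have h3 : (fun k : ℕ => (((2 * k + 3 : ℕ) * Real.pi : ℂ))⁻¹) =O[atTop]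
        fun k => ((2 * k + 3 : ℕ) : ℝ)⁻¹ := by
      refine IsBigO.of_bound (Real.pi⁻¹) (Eventually.of_forall fun k => ?_)
      rw [norm_inv, norm_mul, Complex.norm_natCast, norm_real, norm_inv, Real.norm_natCast,
        Real.norm_of_nonneg Real.pi_pos.le, mul_inv, mul_comm]
    refine (((h1.const_mul_left 2).mul h2).mul h3).congr (fun k => ?_) fun k => by ring
    rw [ResetLoop.Cρ, div_eq_mul_inv]
  have hL : (fun k : ℕ => S.Lρ ω (2 * k + 3)) =O[atTop] fun k => ((2 * k + 3 : ℕ) : ℝ)⁻¹ := by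
    refine ((((hC.mul (hfreq S.C3)).mul (hfreq S.P)).mul (hfreq S.C4)).mul (hfreq S.C1)).congr
      (fun k => rfl) fun k => by ring
  -- Well-posedness says that `1 + L_l` has a non-zero limit at infinity.
  have hI : (fun k : ℕ => (1 + S.Ll ((2 * k + 3 : ℕ) * ω))⁻¹) =O[atTop] fun _ => (1 : ℝ) := by
    refine Tendsto.isBigO_one ℝ ((((S.tendsto_Ll).comp hN).const_add 1).inv₀ ?_)
    exact_mod_cast hwp
  have hΔ : (fun k : ℕ => S.Cr.Δl ((2 * k + 3 : ℕ) * ω) 0) =O[atTop]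
      fun k => (((2 * k + 3 : ℕ) : ℝ) * ω)⁻¹ :=
    (pencil_inv_mulVec_isBigO S.Cr.A (fun i => (S.Cr.B i : ℂ)) 0).comp_tendsto hN
  -- One factor `1/n` comes from `C_ρⁿ`, the other from the decay of `Δ_l(nω)`.
  have hsum : Summable fun k : ℕ => ω⁻¹ * (1 / (((2 * k + 3 : ℕ) : ℝ)) ^ 2) :=
    (((Real.summable_one_div_nat_pow (p := 2)).2 one_lt_two).comp_injective
      (i := fun k : ℕ => 2 * k + 3) fun k l h => by simpa using h).mul_left _
  refine summable_of_isBigO_nat hsum ?_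
  refine ((hL.norm_left.mul hI.norm_left).mul hΔ.norm_left).congr (fun k => ?_) fun k => ?_
  · rw [ResetLoop.Ψ, norm_inv, div_eq_mul_inv]
  · rw [mul_inv]
    ring

end Asymptotics

/-! ### Moduli and phases. -/

section Polar

theorem norm_mul_exp_I_arg (w : ℂ) : ‖w‖ * exp (I * arg w) = w := by
  rw [mul_comm I, norm_mul_exp_arg_mul_I]

theorem exp_I_natCast_arg (n : ℕ) (w : ℂ) : exp (I * n * arg w) = exp (I * arg w) ^ n := by
  rw [← exp_nat_mul]
  ring_nf

theorem exp_I_arg_mul {x y : ℂ} (hx : x ≠ 0) (hy : y ≠ 0) :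
    exp (I * arg (x * y)) = exp (I * arg x) * exp (I * arg y) := by
  have h := norm_mul_exp_I_arg (x * y)
  have hxy : (‖x * y‖ : ℂ) ≠ 0 := by simp [hx, hy]
  apply mul_left_cancel₀ hxy
  rw [h]
  conv_lhs => rw [← norm_mul_exp_I_arg x, ← norm_mul_exp_I_arg y]
  rw [norm_mul]
  push_cast
  ring

/-- `w = |w| exp (j ∠w)` turned into `|w| exp (j n ∠w)`. -/
def phaseMul (n : ℕ) (w : ℂ) : ℂ := ‖w‖ * exp (I * n * arg w)

/-- Arguments add only modulo `2π`, which is harmless because `n` is an integer. -/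
theorem phaseMul_mul (n : ℕ) (x y : ℂ) : phaseMul n (x * y) = phaseMul n x * phaseMul n y := by
  rcases eq_or_ne x 0 with rfl | hx
  · simp [phaseMul]
  rcases eq_or_ne y 0 with rfl | hy
  · simp [phaseMul]
  simp only [phaseMul, exp_I_natCast_arg, exp_I_arg_mul hx hy, norm_mul]
  push_cast
  ring

theorem phaseMul_ofReal (n : ℕ) {r : ℝ} (hr : 0 ≤ r) : phaseMul n r = r := by
  simp [phaseMul, arg_ofReal_of_nonneg hr, abs_of_nonneg hr]

theorem phaseMul_one (w : ℂ) : phaseMul 1 w = w := by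
  simpa [phaseMul] using norm_mul_exp_I_arg w

theorem phaseMul_eq_mul_exp (n : ℕ) (w : ℂ) : phaseMul n w = w * exp (I * (n - 1) * arg w) := by
  have h : I * n * arg w = I * arg w + I * (n - 1) * arg w := by ring
  rw [phaseMul, h, exp_add, ← mul_assoc, norm_mul_exp_I_arg]

theorem im_mul_exp_neg (x : ℂ) (θ : ℝ) :
    (x * exp (-(I * θ))).im = ‖x‖ * Real.sin (arg x - θ) := by
  conv_lhs => rw [← norm_mul_exp_I_arg x]
  have h : I * arg x + -(I * θ) = ((arg x - θ : ℝ) : ℂ) * I := by push_cast; ring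
  rw [mul_assoc, ← exp_add, h, im_ofReal_mul, exp_ofReal_mul_I_im]

/-- With `y = L_ρ` and `w = 1 + L_l` this produces the shape of `Ψ_n Δ_cⁿ`, up to sign. -/
theorem im_mul_div_mul_exp_neg (x y w : ℂ) (θ : ℝ) :
    (x * (y / w) * exp (-(I * θ))).im =
      ‖y‖ / ‖w‖ * (‖x‖ * Real.sin (arg x + arg y - arg w - θ)) := by
  conv_lhs => rw [← norm_mul_exp_I_arg x, ← norm_mul_exp_I_arg y, ← norm_mul_exp_I_arg w]
  have h : (‖x‖ * exp (I * arg x)) * ((‖y‖ * exp (I * arg y)) / (‖w‖ * exp (I * arg w))) *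
      exp (-(I * θ)) = ((‖y‖ / ‖w‖ * ‖x‖ : ℝ) : ℂ) *
        exp (((arg x + arg y - arg w - θ : ℝ) : ℂ) * I) := by
    have h2 : ((arg x + arg y - arg w - θ : ℝ) : ℂ) * I =
        I * arg x + I * arg y + -(I * arg w) + -(I * θ) := by push_cast; ring
    rw [h2, exp_add, exp_add, exp_add, exp_neg (I * arg w)]
    push_cast
    ring
  rw [h, im_ofReal_mul, exp_ofReal_mul_I_im]
  ring

end Polar

/-! ### Harmonic balance of the loop. -/

/-- The higher odd harmonics of a sine wave vanish. -/
theorem segLaplace_sin {ω : ℝ} (hω : 0 < ω) (a : ℝ) {n : ℕ} (hn : Odd n) (hn1 : n ≠ 1) :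
    segLaplace a (a + Real.pi / ω) (I * (n * ω : ℝ)) (fun t => Real.sin (ω * t)) = 0 := by
  have hpos : 0 < Real.pi / ω := by positivity
  have hab : a < a + Real.pi / ω := by linarith
  have hs : exp (-(I * ((n * ω : ℝ) : ℂ) * ((a + Real.pi / ω : ℝ) : ℂ))) =
      -exp (-(I * ((n * ω : ℝ) : ℂ) * a)) := by
    rw [exp_I_mul_add_pi_div n hω, hn.neg_one_pow]; simp
  have harg : ω * (a + Real.pi / ω) = ω * a + Real.pi := by field_simp
  have hsin (t : ℝ) : HasDerivAt (fun t => Real.sin (ω * t)) (ω * Real.cos (ω * t)) t := by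
    have h := ((hasDerivAt_id t).const_mul ω).sin
    simpa [mul_comm] using! h
  have hcos (t : ℝ) : HasDerivAt (fun t => Real.cos (ω * t)) (-ω * Real.sin (ω * t)) t := by
    have h := ((hasDerivAt_id t).const_mul ω).cos
    simpa [mul_comm] using! h
  have cs : Continuous fun t => Real.sin (ω * t) := by fun_prop
  have cc : Continuous fun t => Real.cos (ω * t) := by fun_prop
  have h1 := segLaplace_deriv (I * (n * ω : ℝ)) hab hs cs.continuousOn
    (cs.continuousAt.tendsto.mono_left nhdsWithin_le_nhds)
    ((SegCont.of_continuousOn hab cc.continuousOn).const_mul ω) fun t _ => hsin t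
  have h2 := segLaplace_deriv (I * (n * ω : ℝ)) hab hs cc.continuousOn
    (cc.continuousAt.tendsto.mono_left nhdsWithin_le_nhds)
    ((SegCont.of_continuousOn hab cs.continuousOn).const_mul (-ω)) fun t _ => hcos t
  simp only [harg, Real.sin_add_pi, Real.cos_add_pi] at h1 h2
  rw [segLaplace_const_mul] at h1 h2
  set s := segLaplace a (a + Real.pi / ω) (I * (n * ω : ℝ)) (fun t => Real.sin (ω * t))
  set c := segLaplace a (a + Real.pi / ω) (I * (n * ω : ℝ)) (fun t => Real.cos (ω * t))
  push_cast at h1 h2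
  -- `h1` and `h2` are two linear relations between the transforms of sine and cosine, without
  -- boundary terms by antiperiodicity; the cosine is eliminated.
  have h3 : ((n : ℂ) ^ 2 - 1) * (ω : ℂ) ^ 2 * s = 0 := by
    linear_combination (I * n * ω) * h1 + ω * h2 + n ^ 2 * ω ^ 2 * s * I_sq
  have hω' : (ω : ℂ) ≠ 0 := by exact_mod_cast hω.ne'
  have hn' : ((n : ℂ) ^ 2 - 1) ≠ 0 := by
    intro h
    have h4 : (n : ℂ) ^ 2 = 1 := sub_eq_zero.1 h
    have h5 : n ^ 2 = 1 := by exact_mod_cast h4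
    exact hn1 (by simpa using h5)
  simpa [hω', hn'] using h3

namespace ResetLoop

variable {S : ResetLoop} {ω D : ℝ} {X : S.Trajectory}

theorem mem_resetInstants (hZ : harmonicCoeff ω 1 X.zs ≠ 0) (t : ℝ) :
    t ∈ resetInstants ω X ↔ Real.sin (ω * t + arg (harmonicCoeff ω 1 X.zs)) = 0 := by
  simp [resetInstants, harmonicSignal, hZ]

/-- At a reset instant `ωt` plus the phase of `z_s¹` is a multiple of `π`. This supplies the `σ` of
`one_add_Ll_ne_zero`. -/
theorem exp_of_mem_resetInstants (hZ : harmonicCoeff ω 1 X.zs ≠ 0) (n : ℕ) {t : ℝ}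
    (ht : t ∈ resetInstants ω X) :
    exp (I * (n * ω : ℝ) * t) = exp (-(I * n * arg (harmonicCoeff ω 1 X.zs))) ∨
      exp (I * (n * ω : ℝ) * t) = -exp (-(I * n * arg (harmonicCoeff ω 1 X.zs))) := by
  rw [mem_resetInstants hZ] at ht
  set φ := arg (harmonicCoeff ω 1 X.zs)
  have h1 : exp (I * (n * ω : ℝ) * t) =
      (Real.cos (ω * t + φ) : ℂ) ^ n * exp (-(I * n * φ)) := by
    have h2 : exp (((ω * t + φ : ℝ) : ℂ) * I) = Real.cos (ω * t + φ) := by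
      rw [exp_mul_I, ← ofReal_cos, ← ofReal_sin, ht]
      simp
    rw [← h2, ← exp_nat_mul, ← exp_add]
    congr 1
    push_cast
    ring
  rcases Real.sin_eq_zero_iff_cos_eq.1 ht with h | h
  · left; rw [h1, h]; simp
  · rw [h1, h]
    rcases Nat.even_or_odd n with hn | hn
    · left; simp [hn.neg_one_pow]
    · right; simp [hn.neg_one_pow]

/-- The loop is reduced to one unknown `v`, the reset component of the base-linear response at a
reset instant. It drives every odd harmonic and is in turn a series in the harmonics of `z`.
Summability stays a premise because it is derived from the balance itself. -/
theorem IsTwoResetSteadyState.exists_harmonic_balance (hω : 0 < ω)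
    (hfreq : S.FreqDefined ω) (hwp : S.WellPosed)
    (hdet : (S.Cr.Aρ * S.Cr.expHalf ω + 1).det ≠ 0) (hΔ : S.Δc ω 0 ≠ 0)
    (hX : S.IsTwoResetSteadyState ω (fun _ => 0) (fun t => D * Real.sin (ω * t)) X)
    (hconv : S.IsConvergent (resetInstants ω X) (fun _ => 0) fun t => D * Real.sin (ω * t)) :
    (∀ n : ℕ, Even n → harmonicCoeff ω n X.e = 0) ∧
    harmonicCoeff ω 1 X.zs = S.Cs.freq ω * harmonicCoeff ω 1 X.z ∧
    (∀ n : ℕ, Odd n → harmonicCoeff ω n X.z = S.C1.freq (n * ω) * harmonicCoeff ω n X.e) ∧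
    ∃ v : ℝ,
      (∀ n : ℕ, Odd n → harmonicCoeff ω n X.e * (1 + S.Ll (n * ω)) =
        -(S.P.freq (n * ω) * S.C4.freq (n * ω) * (S.C3.freq (n * ω) *
          ((v / S.Δc ω 0 : ℝ) * (2 * (S.Cr.Δx (n * ω) ⬝ᵥ fun i => (S.Δq ω i : ℂ)) / (n * Real.pi)) *
            exp (I * n * arg (harmonicCoeff ω 1 X.zs))) + if n = 1 then (D : ℂ) else 0))) ∧
      ((Summable fun k : ℕ => S.Cr.Δl ((2 * k + 1 : ℕ) * ω) 0 * harmonicCoeff ω (2 * k + 1) X.z) →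
        HasSum (fun k : ℕ => (S.Cr.Δl ((2 * k + 1 : ℕ) * ω) 0 * harmonicCoeff ω (2 * k + 1) X.z *
          exp (-(I * (2 * k + 1 : ℕ) * arg (harmonicCoeff ω 1 X.zs)))).im) v) := by
  have hZ := hX.trigger_ne_zero
  have hmem := mem_resetInstants hZ
  set J := resetInstants ω X with hJdef
  set φ := arg (harmonicCoeff ω 1 X.zs) with hφ
  have hω' : (ω : ℂ) ≠ 0 := by exact_mod_cast hω.ne'
  have hπ : (Real.pi : ℂ) ≠ 0 := by exact_mod_cast Real.pi_ne_zero
  have hpos : 0 < Real.pi / ω := by positivity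
  -- On the open interval from `a` to `b` the phase `ωt + φ` runs through `(0, π)`, so these are
  -- consecutive reset instants.
  set a := -φ / ω with ha
  set b := a + Real.pi / ω with hb
  have hab : a < b := by linarith
  have haω : ω * a = -φ := by rw [ha]; field_simp
  have hbω : ω * b = -φ + Real.pi := by rw [hb, mul_add, haω]; field_simp
  have haJ : a ∈ J := by rw [hmem, haω]; simp
  have hbJ : b ∈ J := by rw [hmem, hbω]; simp
  have hJ : ∀ t ∈ Ioo a b, t ∉ J := fun t ht => by
    rw [hmem]
    have h1 : ω * a < ω * t := by gcongr; exact ht.1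
    have h2 : ω * t < ω * b := by gcongr; exact ht.2
    exact (Real.sin_pos_of_pos_of_lt_pi (by linarith) (by linarith)).ne'
  have hshift (t : ℝ) : t + Real.pi / ω ∈ J ↔ t ∈ J := by
    rw [hmem, hmem]
    have h1 : ω * (t + Real.pi / ω) + φ = ω * t + φ + Real.pi := by field_simp; ring
    rw [h1, Real.sin_add_pi, neg_eq_zero]
  have hdanti : Function.Antiperiodic (fun t => D * Real.sin (ω * t)) (Real.pi / ω) := fun t => by
    have h1 : ω * (t + Real.pi / ω) = ω * t + Real.pi := by field_simp
    simp only [h1, Real.sin_add_pi]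
    ring
  have hstate := hX.state_antiperiodic hω (fun t => by simp) hdanti hshift hconv
  have hst (t : ℝ) : X.xr (t + Real.pi / ω) = -X.xr t ∧ X.x1 (t + Real.pi / ω) = -X.x1 t ∧
      X.x2 (t + Real.pi / ω) = -X.x2 t ∧ X.x3 (t + Real.pi / ω) = -X.x3 t ∧
      X.x4 (t + Real.pi / ω) = -X.x4 t ∧ X.xs (t + Real.pi / ω) = -X.xs t ∧
      X.xP (t + Real.pi / ω) = -X.xP t := by
    simpa only [Trajectory.state, Prod.neg_mk, Prod.mk.injEq] using hstate t
  have hR := hX.response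
  have herr (t : ℝ) := hR.error_eq hwp (mem_univ t)
  -- Symmetry is known for the states only; the error inherits it through the solved algebraic loop.
  have heanti : Function.Antiperiodic X.e (Real.pi / ω) := fun t => by
    obtain ⟨e1, e2, e3, e4, e5, e6, e7⟩ := hst t
    have hdt : D * Real.sin (ω * (t + Real.pi / ω)) = -(D * Real.sin (ω * t)) := hdanti t
    rw [herr, herr t, e1, e2, e3, e4, e5, e7, hdt]
    simp only [dotProduct_neg]
    ring
  have hzanti : Function.Antiperiodic X.z (Real.pi / ω) := fun t => by
    rw [hR.c1.2.2 _ (mem_univ _), hR.c1.2.2 t (mem_univ _), (hst t).2.1, heanti t, dotProduct_neg]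
    ring
  have hzsanti : Function.Antiperiodic X.zs (Real.pi / ω) := fun t => by
    rw [hR.cs.2.2 _ (mem_univ _), hR.cs.2.2 t (mem_univ _), (hst t).2.2.2.2.2.1, hzanti t,
      dotProduct_neg]
    ring
  obtain ⟨e1, e2, e3, e4, e5, e6, e7⟩ := hst a
  have cd : SegCont a b fun t => D * Real.sin (ω * t) :=
    .of_continuousOn hab (by fun_prop : Continuous fun t => D * Real.sin (ω * t)).continuousOn
  have cr : SegCont a b X.xr := hR.cr.segCont_state hJ haJ hbJ
  have ce : SegCont a b X.e := by
    have h1 : SegCont a b fun t => (0 : ℝ) := .of_continuousOn hab continuousOn_const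
    refine SegCont.congr hab ?_ fun t _ => herr t
    have c1 := (hR.c1.segCont_state hab).dotProduct S.C1.C
    have c2 := (hR.c2.segCont_state hab).dotProduct S.C2.C
    have c3 := (hR.c3.segCont_state hab).dotProduct S.C3.C
    have c4 := (hR.c4.segCont_state hab).dotProduct S.C4.C
    have cP := (hR.p.segCont_state hab).dotProduct S.P.C
    have h2 := c3.add (((cr.dotProduct S.Cr.C).add (c2.add (c1.const_mul
      (S.Cr.D + S.C2.D)))).const_mul S.C3.D)
    have h3 := (c4.add ((cP.add ((h2.add cd).const_mul S.P.D)).const_mul S.C4.D)).const_mul (-1)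
    simpa only [neg_one_mul] using (h1.add h3).const_mul _
  have cz := hR.c1.segCont_output hab ce
  have czs := hR.cs.segCont_output hab cz
  have cm := hR.cr.segCont_output hab hJ haJ hbJ cz
  have ca := hR.c2.segCont_output hab cz
  have cu := hR.c3.segCont_output hab (cm.add ca)
  have cy := hR.p.segCont_output hab (cu.add cd)
  have hs (n : ℕ) (hn : Odd n) : exp (-(I * ((n * ω : ℝ) : ℂ) * (b : ℂ))) =
      -exp (-(I * ((n * ω : ℝ) : ℂ) * a)) := by
    rw [hb, exp_I_mul_add_pi_div n hω, hn.neg_one_pow]; simp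
  have hexp (n : ℕ) : -(I * ((n * ω : ℝ) : ℂ) * a) = I * n * φ := by
    have h1 : (ω : ℂ) * a = -φ := by exact_mod_cast haω
    push_cast
    linear_combination (-I * n) * h1
  have hzE (n : ℕ) (hn : Odd n) :
      harmonicCoeff ω n X.z = S.C1.freq (n * ω) * harmonicCoeff ω n X.e := by
    rw [harmonicCoeff_odd hω hzanti cz hn, harmonicCoeff_odd hω heanti ce hn,
      hR.c1.segLaplace_output hab hJ ce e2 (hs n hn) (hfreq n hn S.C1 (by simp))]
    ring
  refine ⟨fun n hn => harmonicCoeff_even hω heanti ce hn, ?_, hzE, ?_⟩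
  · have := hR.cs.segLaplace_output hab hJ cz e6 (hs 1 odd_one) (hfreq 1 odd_one S.Cs (by simp))
    rw [harmonicCoeff_odd hω hzsanti czs odd_one, harmonicCoeff_odd hω hzanti cz odd_one, this]
    simp only [Nat.cast_one, one_mul]
    ring
  obtain ⟨v, hv1, hv2⟩ := hR.cr.exists_baseLinear hω hJ haJ hbJ cz e1
    (fun n hn => hfreq n hn S.Cr.base (by simp)) hdet
  rw [S.jump_eq_smul_Δq hΔ] at hv1
  refine ⟨v 0, fun n hn => ?_, fun hsum => ?_⟩
  · have hn0 : (n : ℂ) ≠ 0 := by exact_mod_cast hn.pos.ne'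
    have hm := hR.cr.segLaplace_output hab hJ haJ hbJ cz e1 (hs n hn)
      (hfreq n hn S.Cr.base (by simp))
    have hz' := hR.c1.segLaplace_output hab hJ ce e2 (hs n hn) (hfreq n hn S.C1 (by simp))
    have ha' := hR.c2.segLaplace_output hab hJ cz e3 (hs n hn) (hfreq n hn S.C2 (by simp))
    have hu' := hR.c3.segLaplace_output hab hJ (cm.add ca) e4 (hs n hn)
      (hfreq n hn S.C3 (by simp))
    have hy' := hR.p.segLaplace_output hab hJ (cu.add cd) e7 (hs n hn) (hfreq n hn S.P (by simp))
    have hf' := hR.c4.segLaplace_output hab hJ cy e5 (hs n hn) (hfreq n hn S.C4 (by simp))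
    rw [segLaplace_add _ hab cm ca] at hu'
    rw [segLaplace_add _ hab cu cd] at hy'
    have he' : segLaplace a b (I * (n * ω : ℝ)) X.e = -segLaplace a b (I * (n * ω : ℝ)) X.f := by
      rw [segLaplace_congr (g := fun t => -1 * X.f t) _ hab fun t _ => by
        rw [hR.err t (mem_univ t)]; ring, segLaplace_const_mul]
      push_cast
      ring
    have hd' : 2 * I * ((ω / Real.pi : ℝ) : ℂ) * segLaplace a b (I * (n * ω : ℝ))
        (fun t => D * Real.sin (ω * t)) = if n = 1 then (D : ℂ) else 0 := by
      split_ifs with h1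
      · subst h1
        rw [← harmonicCoeff_odd hω hdanti cd hn]
        simpa using harmonicCoeff_sin hω D one_ne_zero
      · rw [segLaplace_const_mul, segLaplace_sin hω a hn h1]
        simp
    -- The factor `2iω/π` equals `(inω) · 2/(nπ)`, and `inω` is the factor contained in `Δ_x(nω)`.
    have hjump : 2 * I * ((ω / Real.pi : ℝ) : ℂ) * ((fun i => (S.Cr.C i : ℂ)) ⬝ᵥ
        ((pencil S.Cr.A (n * ω))⁻¹ *ᵥ fun i => (((S.Cr.Aρ - 1) *ᵥ X.xr a) i : ℂ))) =
        (v 0 / S.Δc ω 0 : ℝ) *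
          (2 * (S.Cr.Δx (n * ω) ⬝ᵥ fun i => (S.Δq ω i : ℂ)) / (n * Real.pi)) := by
      have h1 : (fun i => (((S.Cr.Aρ - 1) *ᵥ X.xr a) i : ℂ)) =
          ((v 0 / S.Δc ω 0 : ℝ) : ℂ) • fun i => (S.Δq ω i : ℂ) := by
        ext i
        rw [hv1]
        simp
      rw [h1, mulVec_smul, dotProduct_smul, dotProduct_mulVec, ResetController.Δx, smul_dotProduct]
      simp only [smul_eq_mul]
      push_cast
      field_simp
    rw [hexp] at hm
    rw [harmonicCoeff_odd hω heanti ce hn, ← hd', ← hjump, ResetLoop.Ll]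
    rw [hf', hy', hu', hm, ha', hz'] at he'
    linear_combination 2 * I * ((ω / Real.pi : ℝ) : ℂ) * he'
  · have hseg (n : ℕ) (hn : Odd n) := harmonicCoeff_odd hω hzanti cz hn
    have hκ : 2 * I * ((ω / Real.pi : ℝ) : ℂ) ≠ 0 := by
      push_cast
      simp [hω', hπ]
    have h1 := hv2 0 ?_
    · convert h1 using 3 with k
      rw [hseg _ ⟨k, rfl⟩, ← hexp, neg_neg]
      ring
    · refine (hsum.mul_left (2 * I * ((ω / Real.pi : ℝ) : ℂ))⁻¹).congr fun k => ?_
      rw [hseg _ ⟨k, rfl⟩, mul_left_comm (S.Cr.Δl _ _), inv_mul_cancel_left₀ hκ]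

end ResetLoop

namespace ResetLoop

variable {S : ResetLoop} {ω D : ℝ} {X : S.Trajectory}

/-- The harmonics of the error satisfy the balance equations of the loop, in which `Γ(ω)` is the
ratio of the jump of the reset controller to the one that the first harmonic of its input alone
would cause. -/
theorem IsTwoResetSteadyState.harmonic_balance (hω : 0 < ω)
    (hfreq : S.FreqDefined ω) (hwp : S.WellPosed)
    (hdet : (S.Cr.Aρ * S.Cr.expHalf ω + 1).det ≠ 0) (hΔ : S.Δc ω 0 ≠ 0)
    (hX : S.IsTwoResetSteadyState ω (fun _ => 0) (fun t => D * Real.sin (ω * t)) X)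
    (hconv : S.IsConvergent (resetInstants ω X) (fun _ => 0) fun t => D * Real.sin (ω * t)) :
    (∀ n : ℕ, Odd n → 1 < n → 1 + S.Ll (n * ω) ≠ 0) ∧ Summable (S.ΓTerm ω) ∧ S.ΓDen ω ≠ 0 ∧
    (∀ n : ℕ, Even n → harmonicCoeff ω n X.e = 0) ∧
    ∀ n : ℕ, Odd n → harmonicCoeff ω n X.e * (1 + S.Ll (n * ω)) =
      -(S.P.freq (n * ω) * S.C4.freq (n * ω) * (S.C3.freq (n * ω) * (S.Γ ω * S.Cρ ω n *
        phaseMul n (S.C1.freq ω * harmonicCoeff ω 1 X.e)) + if n = 1 then (D : ℂ) else 0)) := by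
  obtain ⟨heven, hzs, hz, v, hbal, hsum⟩ :=
    hX.exists_harmonic_balance hω hfreq hwp hdet hΔ hconv
  have hZs := hX.trigger_ne_zero
  have hLl : ∀ n : ℕ, Odd n → 1 + S.Ll (n * ω) ≠ 0 := fun n hn =>
    hconv.one_add_Ll_ne_zero hX.response hwp (mul_pos (by exact_mod_cast hn.pos) hω)
      (hfreq n hn) fun t ht => exp_of_mem_resetInstants hZs n ht
  set Z := harmonicCoeff ω 1 X.z with hZdef
  set θ := arg (S.Cs.freq ω) with hθ
  have hCs : S.Cs.freq ω ≠ 0 := fun h => hZs (by rw [hzs, h, zero_mul])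
  have hZ : Z ≠ 0 := fun h => hZs (by rw [hzs, h, mul_zero])
  have hZn : (‖Z‖ : ℂ) ≠ 0 := by simpa using hZ
  have hZn' : ‖Z‖ ≠ 0 := by simpa using hZ
  have hphase (n : ℕ) : ‖Z‖ * exp (I * n * arg (harmonicCoeff ω 1 X.zs)) =
      exp (I * n * θ) * phaseMul n Z := by
    rw [hzs, exp_I_natCast_arg, exp_I_arg_mul hCs hZ, phaseMul, hθ, exp_I_natCast_arg n (S.Cs.freq ω),
      exp_I_natCast_arg n Z]
    ring
  -- The first harmonic of `z` alone would give `v = ‖Z‖ Δ_c¹`, so `c` is the ratio of the actual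
  -- jump to that one.
  set c := v / S.Δc ω 0 / ‖Z‖ with hc
  have hv : v = c * ‖Z‖ * S.Δc ω 0 := by rw [hc]; field_simp
  have hbal' (n : ℕ) (hn : Odd n) : harmonicCoeff ω n X.e * (1 + S.Ll (n * ω)) =
      -(S.P.freq (n * ω) * S.C4.freq (n * ω) * (S.C3.freq (n * ω) * (c * S.Cρ ω n *
        phaseMul n Z) + if n = 1 then (D : ℂ) else 0)) := by
    have h1 : ((v / S.Δc ω 0 : ℝ) : ℂ) = c * ‖Z‖ := by
      rw [hc]; push_cast; field_simp
    rw [hbal n hn, h1, ResetLoop.Cρ]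
    linear_combination (-(S.P.freq (n * ω) * S.C4.freq (n * ω) * S.C3.freq (n * ω) * c *
      (2 * (S.Cr.Δx (n * ω) ⬝ᵥ fun i => (S.Δq ω i : ℂ)) / (n * Real.pi)))) * hphase n
  clear_value c
  -- The disturbance has no harmonic `n ≠ 1`, so these harmonics come from the jump alone and are
  -- proportional to `c`.
  have hz' (n : ℕ) (hn : Odd n) (hn1 : n ≠ 1) : harmonicCoeff ω n X.z =
      -c * (S.Lρ ω n / (1 + S.Ll (n * ω))) * phaseMul n Z := by
    have h1 := hbal' n hn
    rw [if_neg hn1] at h1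
    rw [hz n hn, ResetLoop.Lρ]
    have h2 := hLl n hn
    field_simp
    linear_combination S.C1.freq (n * ω) * h1
  have hphase' (n : ℕ) : phaseMul n Z * exp (-(I * n * arg (harmonicCoeff ω 1 X.zs))) =
      ‖Z‖ * exp (-(I * (n * θ : ℝ))) := by
    have h1 := hphase n
    rw [exp_neg, exp_neg]
    have h2 := exp_ne_zero (I * n * arg (harmonicCoeff ω 1 X.zs))
    have h3 : exp (I * n * θ) = exp (I * (n * θ : ℝ)) := by push_cast; ring_nf
    rw [h3] at h1
    have h4 := exp_ne_zero (I * (n * θ : ℝ))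
    field_simp
    linear_combination -h1
  have hnorm (n : ℕ) : ‖phaseMul n Z‖ = ‖Z‖ := by
    rw [phaseMul, norm_mul, norm_exp_I_mul_natCast_mul]
    simp
  have hdom := S.summable_Ψ_mul_Δl hwp hω
  have hodd (k : ℕ) : Odd (2 * k + 3) := ⟨k + 1, by ring⟩
  have hΓ : Summable (S.ΓTerm ω) := by
    refine Summable.of_norm_bounded hdom fun k => ?_
    have h1 : 0 ≤ S.Ψ ω (2 * k + 3) := by rw [ResetLoop.Ψ]; positivity
    rw [ResetLoop.ΓTerm, ResetLoop.Δcn, if_neg (by omega), norm_mul, Real.norm_of_nonneg h1, norm_neg,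
      norm_mul, norm_norm]
    gcongr
    exact mul_le_of_le_one_right (norm_nonneg _) (Real.abs_sin_le_one _)
  have hsummable : Summable fun k : ℕ =>
      S.Cr.Δl ((2 * k + 1 : ℕ) * ω) 0 * harmonicCoeff ω (2 * k + 1) X.z := by
    rw [← summable_nat_add_iff 1]
    refine Summable.of_norm_bounded (hdom.mul_left (|c| * ‖Z‖)) fun k => ?_
    have h1 : 2 * (k + 1) + 1 = 2 * k + 3 := by ring
    rw [h1, hz' _ (hodd k) (by omega), norm_mul, norm_mul, norm_mul, norm_neg, norm_real, norm_div,
      hnorm, ResetLoop.Ψ, Real.norm_eq_abs]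
    apply le_of_eq
    ring
  have hterms := hsum hsummable
  rw [← hasSum_nat_add_iff' 1] at hterms
  have hterm (k : ℕ) : (S.Cr.Δl ((2 * (k + 1) + 1 : ℕ) * ω) 0 *
      harmonicCoeff ω (2 * (k + 1) + 1) X.z *
        exp (-(I * (2 * (k + 1) + 1 : ℕ) * arg (harmonicCoeff ω 1 X.zs)))).im =
      c * ‖Z‖ * S.ΓTerm ω k := by
    have h1 : 2 * (k + 1) + 1 = 2 * k + 3 := by ring
    rw [h1, hz' _ (hodd k) (by omega)]
    have h2 : S.Cr.Δl ((2 * k + 3 : ℕ) * ω) 0 *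
        (-c * (S.Lρ ω (2 * k + 3) / (1 + S.Ll ((2 * k + 3 : ℕ) * ω))) * phaseMul (2 * k + 3) Z) *
          exp (-(I * (2 * k + 3 : ℕ) * arg (harmonicCoeff ω 1 X.zs))) =
        ((-c * ‖Z‖ : ℝ) : ℂ) * (S.Cr.Δl ((2 * k + 3 : ℕ) * ω) 0 *
          (S.Lρ ω (2 * k + 3) / (1 + S.Ll ((2 * k + 3 : ℕ) * ω))) *
            exp (-(I * ((2 * k + 3 : ℕ) * θ : ℝ)))) := by
      push_cast
      have h3 := hphase' (2 * k + 3)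
      push_cast at h3
      linear_combination (-c * S.Cr.Δl ((2 * k + 3 : ℝ) * ω) 0 *
        (S.Lρ ω (2 * k + 3) / (1 + S.Ll ((2 * k + 3 : ℝ) * ω)))) * h3
    rw [h2, im_ofReal_mul, im_mul_div_mul_exp_neg, ResetLoop.ΓTerm, ResetLoop.Δcn, if_neg (by omega),
      ResetLoop.Ψ]
    ring
  have hfirst : (S.Cr.Δl ((2 * 0 + 1 : ℕ) * ω) 0 * harmonicCoeff ω (2 * 0 + 1) X.z *
      exp (-(I * (2 * 0 + 1 : ℕ) * arg (harmonicCoeff ω 1 X.zs)))).im = ‖Z‖ * S.Δc ω 0 := by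
    have h1 := hphase' 1
    rw [phaseMul_one] at h1
    simp only [mul_zero, zero_add, ← hZdef]
    rw [mul_assoc, h1, mul_left_comm, im_ofReal_mul, im_mul_exp_neg, ResetLoop.Δc]
    simp [hθ]
  simp only [hterm, Finset.range_one, Finset.sum_singleton, hfirst] at hterms
  -- Two values of the tail `n ≥ 3`: `c ‖Z‖ ∑ Ψ_n Δ_cⁿ` and `v - ‖Z‖ Δ_c¹`. Inserting `v = c ‖Z‖
  -- Δ_c¹` gives the linear equation that determines `c`.
  have hkey := (hΓ.hasSum.mul_left (c * ‖Z‖)).unique hterms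
  have hcΓ : c * S.ΓDen ω = 1 := by
    rw [ResetLoop.ΓDen, ResetLoop.Δcn, if_pos rfl]
    rw [hv] at hkey
    have h1 : ‖Z‖ * (c * ∑' k, S.ΓTerm ω k) = ‖Z‖ * ((c - 1) * S.Δc ω 0) := by
      linear_combination hkey
    have h2 := mul_left_cancel₀ hZn' h1
    field_simp
    linear_combination -h2
  have hΓc : S.Γ ω = c := by
    rw [ResetLoop.Γ, eq_comm]
    exact eq_one_div_of_mul_eq_one_left hcΓ
  refine ⟨fun n hn _ => hLl n hn, hΓ, right_ne_zero_of_mul_eq_one hcΓ, heven, fun n hn => ?_⟩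
  have h1 := hz 1 odd_one
  rw [Nat.cast_one, one_mul] at h1
  rw [hΓc, ← h1]
  exact hbal' n hn

end ResetLoop

end

/-! ### The process sensitivity functions. -/

theorem corollary1 (S : ResetLoop) (ω D : ℝ) (hω : 0 < ω) (hD : 0 < D)
    -- the functions in the formulas are defined
    (hfreq : S.FreqDefined ω) (hwp : S.WellPosed)
    (hdet : (S.Cr.Aρ * S.Cr.expHalf ω + 1).det ≠ 0) (hΔ : S.Δcn ω 1 ≠ 0)
    -- the two-reset steady-state response to the disturbance
    (X : S.Trajectory)
    (hX : S.IsTwoResetSteadyState ω (fun _ => 0) (fun t => D * Real.sin (ω * t)) X)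
    (hconv : S.IsConvergent (ResetLoop.resetInstants ω X) (fun _ => 0)
      (fun t => D * Real.sin (ω * t))) :
    -- no division by zero and no divergent series in the formulas
    ((∀ n : ℕ, Odd n → 1 < n → 1 + S.Ll (n * ω) ≠ 0) ∧ Summable (S.ΓTerm ω) ∧ S.ΓDen ω ≠ 0 ∧
      1 + S.Lo ω ≠ 0) ∧
    -- first harmonic
    ResetLoop.PS ω D X 1 = -(S.P.freq ω * S.C4.freq ω) / (1 + S.Lo ω) ∧
    -- odd harmonics of higher order
    (∀ n : ℕ, Odd n → 1 < n →
      ResetLoop.PS ω D X n =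
        -S.Sl (n * ω) *
          (‖ResetLoop.PS ω D X 1‖ * Complex.exp (Complex.I * n * Complex.arg (ResetLoop.PS ω D X 1)))
          * S.Γ ω * S.L ω n * S.C4.freq (n * ω)) ∧
    -- even harmonics
    (∀ n : ℕ, Even n → 2 ≤ n → ResetLoop.PS ω D X n = 0) := by
  have hDc : (D : ℂ) ≠ 0 := by exact_mod_cast hD.ne'
  have hΔ' : S.Δc ω 0 ≠ 0 := by simpa [ResetLoop.Δcn] using hΔ
  obtain ⟨hLl, hsum, hden, heven, hbal⟩ := hX.harmonic_balance hω hfreq hwp hdet hΔ' hconv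
  have hPS (n : ℕ) (hn : n ≠ 0) : ResetLoop.PS ω D X n = harmonicCoeff ω n X.e / D := by
    rw [ResetLoop.PS, harmonicCoeff_sin hω D hn]
  have hE : harmonicCoeff ω 1 X.e = ResetLoop.PS ω D X 1 * D := by
    rw [hPS 1 one_ne_zero]
    field_simp
  have hLo : S.Lo ω = S.Ll ω + S.Γ ω * S.Lρ ω 1 := by
    simp only [ResetLoop.Lo, ResetLoop.L, ResetLoop.Ll, ResetLoop.Lρ, if_true, Nat.cast_one, one_mul]
    ring
  have hfirst : ResetLoop.PS ω D X 1 * (1 + S.Lo ω) = -(S.P.freq ω * S.C4.freq ω) := by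
    have h1 := hbal 1 odd_one
    simp only [phaseMul_one, if_true, Nat.cast_one, one_mul, hE] at h1
    apply mul_right_cancel₀ hDc
    simp only [hLo, ResetLoop.Lρ, Nat.cast_one, one_mul]
    linear_combination h1
  -- If it vanished, the first balance would give `P C₄ = 0`; but `P C₄` is a factor of `L_o`, so
  -- `L_o` would be `0` and not `-1`.
  have hLo_ne : 1 + S.Lo ω ≠ 0 := by
    intro h
    rw [h, mul_zero] at hfirst
    have hPC : S.P.freq ω * S.C4.freq ω = 0 := neg_eq_zero.1 hfirst.symm
    have h1 : S.Lo ω = 0 := by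
      simp only [hLo, ResetLoop.Ll, ResetLoop.Lρ, Nat.cast_one, one_mul]
      linear_combination ((S.Cr.base.freq ω + S.C2.freq ω) * S.C3.freq ω * S.C1.freq ω +
        S.Γ ω * S.Cρ ω 1 * S.C3.freq ω * S.C1.freq ω) * hPC
    simp [h1] at h
  refine ⟨⟨hLl, hsum, hden, hLo_ne⟩, ?_, fun n hn hn1 => ?_, fun n hn hn2 => ?_⟩
  · rw [eq_div_iff hLo_ne, hfirst]
  · have h1 := hbal n hn
    -- The phase multiplication splits over `C₁`, `PS₁` and `D`: the first gives the phase factor in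
    -- `L_n`, the second the one in the formula, and `D > 0` has no phase.
    rw [if_neg hn1.ne', hE, phaseMul_mul, phaseMul_mul, phaseMul_ofReal n hD.le,
      phaseMul_eq_mul_exp n (S.C1.freq ω)] at h1
    have h2 := hLl n hn hn1
    change _ = -S.Sl (n * ω) * phaseMul n (ResetLoop.PS ω D X 1) * S.Γ ω * S.L ω n * _
    rw [hPS n (by omega), ResetLoop.L, if_neg hn1.ne', if_pos hn, ResetLoop.Sl]
    field_simp
    linear_combination h1
  · rw [hPS n (by omega), heven n hn, zero_div]
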